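/- Setting. Let $d\ge 1$ and let $\mathcal X\subset\mathbb R^d$ be compact with $\mathcal X=\overline{\operatorname{int}\mathcal X}$. Let $\mathbb P_X$ be a probability measure on $\mathcal X$ with a Lebesgue density and with support $\mathcal X$, and write $\|f\|_2$ and $\langle f,g\rangle_2$ for the norm and inner product of $L^2(\mathbb P_X)$. Let $K:\mathcal X\times\mathcal X\to\mathbb R$ be a Mercer kernel (continuous, symmetric, positive semidefinite), and let $L_Kf(x)=\int_{\mathcal X}K(x,x')f(x')\,d\mathbb P_X(x')$. Suppose that $L_K$ has eigenvalues $\mu_1\ge\mu_2\ge\cdots>0$, $\mu_i\to0$, with eigenfunctions $\psi_i$ ($L_K\psi_i=\mu_i\psi_i$ on $\mathcal X$) that form an orthonormal basis of $L^2(\mathbb P_X)$. For $s\in\mathbb R$, $L_K^sf\in L^2(\mathbb P_X)$ means that there is $g\in L^2(\mathbb P_X)$ with $\langle g,\psi_i\rangle_2=\mu_i^s\langle f,\psi_i\rangle_2$ for all $i$, and then $L_K^sf:=g$. For a multi-index $\beta\in\mathbb N_0^d$ put $|\beta|=\beta_1+\cdots+\beta_d$. We write $f\in C^m(\mathcal X)$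 if $f$ is continuous on $\mathcal X$ and, for all $|\beta|\le m$, $\partial^\beta f$ exists in $\operatorname{int}\mathcal X$ and extends continuously to $\mathcal X$; and $K\in C^{2m}(\mathcal X,\mathcal X)$ if $K$ is continuous and, for all $|\beta|\le m$, $\partial^{\beta,\beta}K(x,x')=\partial_x^\beta\partial_{x'}^\beta K(x,x')$ exists in $\operatorname{int}\mathcal X\times\operatorname{int}\mathcal X$ and extends continuously to $\mathcal X\times\mathcal X$. On the boundary, derivatives denote these extensions. $\|\cdot\|_\infty$ is the supremum norm on $\mathcal X$, $\zeta$ is the Riemann zeta function, and $\kappa_\beta:=\big(\sup_{x\in\mathcal X}\partial^{\beta,\beta}K(x,x)\big)^{1/2}$. Theorem. Let $m\in\mathbb N_0$, $K\in C^{2m}(\mathcal X,\mathcal X)$, $f_0\in C^m(\mathcal X)$ and $|\beta|\le m$. For every $\lambda>0$ the function $f_\lambda=(L_K+\lambda I)^{-1}L_Kf_0$, that is, the square integrable function with $L_Kf_\lambda(x)+\lambda f_\lambda(x)=L_Kf_0(x)$ for all $x\in\mathcal X$, exists and lies in $C^m(\mathcal X)$, and the following hold. (a) Suppose that there is $C_\psi>0$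 with $\|\psi_i\|_\infty\le C_\psi$ for all $i$, and that $L_K^{-r-1/2}f_0\in L^2(\mathbb P_X)$ for some $0<r\le 1/2$. Then for all $\lambda>0$ $$\|\partial^\beta f_\lambda-\partial^\beta f_0\|_\infty\le\kappa_\beta\,\lambda^r\,\|L_K^{-r-1/2}f_0\|_2 .$$ (b) Suppose that $\mathcal X=[0,1]^d$, that $\mathbb P_X$ is the uniform distribution, and that every $\psi_i$ belongs to the Fourier system $1,\ \sqrt2\cos(2\pi k\cdot x),\ \sqrt2\sin(2\pi k\cdot x)$, $k\in\mathbb Z^d\setminus\{0\}$. Suppose further that for some $0<r\le1$ and some integer $p>d+|\beta|$, $L_K^{-r}f_0$ is of class $C^p$ on the torus, i.e. it agrees on $[0,1]^d$ (almost everywhere) with a $\mathbb Z^d$-periodic function in $C^p(\mathbb R^d)$. Then there is a constant $C>0$, not depending on $\lambda$, such that for all $\lambda>0$ $$\|\partial^\beta f_\lambda-\partial^\beta f_0\|_\infty\le C\,\lambda^r\,\zeta(p-d+1-|\beta|).$$ -/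

import Mathlib

open MeasureTheory Set Filter Topology

namespace KRR

/-- `d`-dimensional Euclidean space. -/
abbrev E (d : ℕ) : Type := EuclideanSpace ℝ (Fin d)

noncomputable section

/-! ### Partial derivatives and the spaces `C^m(X)`, `C^{2m}(X, X)` -/

/-- The order `|β| = β₁ + ⋯ + β_d` of a multi-index. -/
def order {d : ℕ} (β : Fin d → ℕ) : ℕ := ∑ i, β i

/-- The list `[1, …, 1, 2, …, 2, …, d, …, d]` with `β i` copies of each index `i`. -/
def indexList {d : ℕ} (β : Fin d → ℕ) : List (Fin d) :=
  (List.finRange d).flatMap fun i => List.replicate (β i) i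

/-- `iterPartial [i₁, …, iₙ] f = ∂_{i₁} ⋯ ∂_{iₙ} f` (the derivative `∂_{iₙ}` is taken first). -/
def iterPartial {d : ℕ} : List (Fin d) → (E d → ℝ) → E d → ℝ
  | [], f => f
  | i :: l, f => fun x => lineDeriv ℝ (iterPartial l f) x (EuclideanSpace.single i (1 : ℝ))

/-- All the partial derivatives taken successively in `∂_{i₁} ⋯ ∂_{iₙ} f` exist on `U`. -/
def HasIterPartialOn {d : ℕ} (U : Set (E d)) : List (Fin d) → (E d → ℝ) → Prop
  | [], _ => True
  | i :: l, f => HasIterPartialOn U l f ∧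
      ∀ x ∈ U, LineDifferentiableAt ℝ (iterPartial l f) x (EuclideanSpace.single i (1 : ℝ))

/-- `∂^β f = ∂_{x₁}^{β₁} ⋯ ∂_{x_d}^{β_d} f`, meaningful on an open set where it exists. -/
def mpartial {d : ℕ} (β : Fin d → ℕ) (f : E d → ℝ) : E d → ℝ := iterPartial (indexList β) f

/-- `∂^β f` exists on `U`. -/
def HasMPartialOn {d : ℕ} (U : Set (E d)) (β : Fin d → ℕ) (f : E d → ℝ) : Prop :=
  HasIterPartialOn U (indexList β) f

/-- `f ∈ C^m(X)`: `f` is continuous on `X`, and each `∂^β f` with `|β| ≤ m` exists in the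
interior of `X` and extends continuously to `X`. -/
def IsCm {d : ℕ} (X : Set (E d)) (m : ℕ) (f : E d → ℝ) : Prop :=
  ContinuousOn f X ∧ ∀ β : Fin d → ℕ, order β ≤ m →
    HasMPartialOn (interior X) β f ∧
      ∃ g : E d → ℝ, ContinuousOn g X ∧ EqOn g (mpartial β f) (interior X)

/-- `∂^β f` as a function on `X`: the continuous extension of `∂^β f` from the interior of `X`. -/
def derivOn {d : ℕ} (X : Set (E d)) (β : Fin d → ℕ) (f : E d → ℝ) : E d → ℝ :=
  extendFrom (interior X) (mpartial β f)

/-- `∂^{β,β} K(x, x') = ∂_x^β ∂_{x'}^β K(x, x')`, meaningful on an open set where it exists. -/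
def mpartial₂ {d : ℕ} (β : Fin d → ℕ) (K : E d → E d → ℝ) (z : E d × E d) : ℝ :=
  mpartial β (fun x => mpartial β (K x) z.2) z.1

/-- `K ∈ C^{2m}(X, X)`: `K` is continuous on `X × X`, and each `∂^{β,β} K` with `|β| ≤ m` exists
in `interior X × interior X` and extends continuously to `X × X`. -/
def IsC2m {d : ℕ} (X : Set (E d)) (m : ℕ) (K : E d → E d → ℝ) : Prop :=
  ContinuousOn (fun z : E d × E d => K z.1 z.2) (X ×ˢ X) ∧
  ∀ β : Fin d → ℕ, order β ≤ m →
    (∀ x ∈ interior X, HasMPartialOn (interior X) β (K x)) ∧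
    (∀ y ∈ interior X, HasMPartialOn (interior X) β (fun x => mpartial β (K x) y)) ∧
    ∃ G : E d × E d → ℝ, ContinuousOn G (X ×ˢ X) ∧
      EqOn G (mpartial₂ β K) (interior X ×ˢ interior X)

/-- `∂^{β,β} K` as a function on `X × X` (continuous extension from the interior). -/
def derivOn₂ {d : ℕ} (X : Set (E d)) (β : Fin d → ℕ) (K : E d → E d → ℝ) : E d × E d → ℝ :=
  extendFrom (interior X ×ˢ interior X) (mpartial₂ β K)

/-- `κ_β = (sup_{x ∈ X} ∂^{β,β} K(x, x))^{1/2}`. -/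
def kappa {d : ℕ} (X : Set (E d)) (β : Fin d → ℕ) (K : E d → E d → ℝ) : ℝ :=
  Real.sqrt (sSup ((fun x => derivOn₂ X β K (x, x)) '' X))

/-- The sup norm over `X`. -/
def supNorm {d : ℕ} (X : Set (E d)) (f : E d → ℝ) : ENNReal := ⨆ x ∈ X, ‖f x‖ₑ

/-! ### Mercer kernels, the integral operator, its spectral decomposition and powers -/

/-- A Mercer kernel on `X`: continuous, symmetric and positive (semi)definite. -/
structure IsMercerKernel {d : ℕ} (X : Set (E d)) (K : E d → E d → ℝ) : Prop where
  continuousOn : ContinuousOn (fun z : E d × E d => K z.1 z.2) (X ×ˢ X)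
  symm : ∀ x ∈ X, ∀ y ∈ X, K x y = K y x
  nonneg : ∀ (n : ℕ) (x : Fin n → E d) (c : Fin n → ℝ), (∀ i, x i ∈ X) →
    0 ≤ ∑ i, ∑ j, c i * c j * K (x i) (x j)

/-- The integral operator `(L_K f)(x) = ∫ K(x, x') f(x') dP(x')`. -/
def intOp {d : ℕ} (P : Measure (E d)) (K : E d → E d → ℝ) (f : E d → ℝ) (x : E d) : ℝ :=
  ∫ y, K x y * f y ∂P

/-- The coefficient `⟨f, g⟩` in `L²(P)`. -/
def l2inner {d : ℕ} (P : Measure (E d)) (f g : E d → ℝ) : ℝ := ∫ x, f x * g x ∂P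

/-- `(ev i, ψ i)` are the eigenvalues (positive, nonincreasing, tending to zero) and
eigenfunctions of `L_K`, the latter being an orthonormal basis of `L²(P)`. -/
structure IsEigenSystem {d : ℕ} (X : Set (E d)) (P : Measure (E d)) (K : E d → E d → ℝ)
    (ev : ℕ → ℝ) (ψ : ℕ → E d → ℝ) : Prop where
  pos : ∀ i, 0 < ev i
  anti : Antitone ev
  tendsto_zero : Tendsto ev atTop (𝓝 0)
  memLp : ∀ i, MemLp (ψ i) 2 P
  eigen : ∀ i, ∀ x ∈ X, intOp P K (ψ i) x = ev i * ψ i x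
  orthonormal : ∀ i j, l2inner P (ψ i) (ψ j) = if i = j then 1 else 0
  complete : ∀ f : E d → ℝ, MemLp f 2 P → (∀ i, l2inner P f (ψ i) = 0) → f =ᵐ[P] 0

/-- `L_K^s f = g` with `g ∈ L²(P)`: in the eigenbasis `g` has the coefficients `ev i ^ s * f_i`.
Thus `L_K^s f ∈ L²(P)` means that such a `g` exists, and `g` is then unique `P`-a.e. -/
def IsPow {d : ℕ} (P : Measure (E d)) (ev : ℕ → ℝ) (ψ : ℕ → E d → ℝ) (s : ℝ)
    (f g : E d → ℝ) : Prop :=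
  MemLp g 2 P ∧ ∀ i, l2inner P g (ψ i) = ev i ^ s * l2inner P f (ψ i)

/-- `F = (L_K + lam I)⁻¹ L_K f₀` on `X`: `F` is the square integrable function with
`(L_K + lam I) F = L_K f₀` at every point of `X`. -/
def IsRegularized {d : ℕ} (X : Set (E d)) (P : Measure (E d)) (K : E d → E d → ℝ)
    (lam : ℝ) (f₀ F : E d → ℝ) : Prop :=
  MemLp F 2 P ∧ ∀ x ∈ X, intOp P K F x + lam * F x = intOp P K f₀ x

/-! ### The Fourier basis on the unit cube -/

/-- The unit cube `[0,1]^d`. -/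
def cube (d : ℕ) : Set (E d) := {x | ∀ i, x i ∈ Icc (0 : ℝ) 1}

/-- `2π k · x`. -/
def phase {d : ℕ} (k : Fin d → ℤ) (x : E d) : ℝ := 2 * Real.pi * ∑ i, (k i : ℝ) * x i

/-- `φ` is, on the unit cube, a member of the (normalised) real Fourier system
`1, √2 cos(2π k · x), √2 sin(2π k · x)`, `k ∈ ℤ^d ∖ {0}`. -/
def IsFourierFunction {d : ℕ} (φ : E d → ℝ) : Prop :=
  (∀ x ∈ cube d, φ x = 1) ∨
  ∃ k : Fin d → ℤ, k ≠ 0 ∧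
    ((∀ x ∈ cube d, φ x = Real.sqrt 2 * Real.cos (phase k x)) ∨
     (∀ x ∈ cube d, φ x = Real.sqrt 2 * Real.sin (phase k x)))

/-- `g` is of class `C^p` on the torus `ℝ^d / ℤ^d`. -/
def IsPeriodicCp {d : ℕ} (p : ℕ) (g : E d → ℝ) : Prop :=
  ContDiff ℝ p g ∧ ∀ (i : Fin d) (x : E d), g (x + EuclideanSpace.single i (1 : ℝ)) = g x

end

end KRR

/-! ### Feature maps of Mercer kernels -/

namespace KRR
variable {d : ℕ}

/-! Write `K x y = ⟨Φ x, Φ y⟩` with a feature map `Φ` into a Hilbert space `H`. A function `⟨Φ ·,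
w⟩` inherits the regularity of `Φ`, and `Φ` has strong derivatives up to order `m`: by the mean
value theorem in both variables, inner products of its iterated difference quotients are values of
`∂^{β,β}K` at nearby points, so the quotients are Cauchy (`exists_iterPartial_feature`). The
derivative `Ψ` of `Φ` satisfies `‖Ψ x‖ ≤ κ_β`, also on the boundary
(`IsC2m.exists_partial_feature`).

The operator `synth` is adjoint to `w ↦ ⟨Φ ·, w⟩`, so `L_K f = ⟨Φ ·, synth f⟩`. The equation for `F`
itself then shows that `F` is of this form, hence `C^m`. In the eigenbasis, `F - f₀` has the
coefficients `-λ/(μ_i + λ)` times those of `f₀`, and everything rests on `λ μ^r/(μ + λ) ≤ λ^r` for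
`0 ≤ r ≤ 1` (`mul_rpow_div_add_le`).

For (a), the source condition gives `F - f₀ = ⟨Φ ·, w⟩` with `‖w‖ ≤ λ^r ‖g‖₂`, where `g =
L_K^{-r-1/2} f₀`; Cauchy-Schwarz against `Ψ x` gives the bound.

For (b), integration by parts makes the Fourier coefficients of `g = L_K^{-r} f₀` decay like `(1 +
‖k‖)^{-p}`. Those of `F - f₀` are smaller by the factor `λ^r`, and the series may be differentiated
termwise because `p - |β| ≥ d + 1` (`exists_fourier_error`). The zeta value is only a positive
constant to be absorbed into `C`. -/

open scoped ComplexOrder in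
/-- A Mercer kernel is the Gram kernel of a feature map into a real Hilbert space. -/
theorem IsMercerKernel.exists_feature {X : Set (E d)} {K : E d → E d → ℝ}
    (hK : IsMercerKernel X K) :
    ∃ (H : Type) (_ : NormedAddCommGroup H) (_ : InnerProductSpace ℝ H) (_ : CompleteSpace H)
      (Φ : E d → H), ∀ x ∈ X, ∀ y ∈ X, inner ℝ (Φ x) (Φ y) = K x y := by
  classical
  -- The scalar kernel is viewed as an operator-valued one on `ℝ`, so that `H` can be its
  -- reproducing kernel Hilbert space and `Φ x` the kernel function at `x`.
  let M : Matrix X X (ℝ →L[ℝ] ℝ) := .of fun x y => K x y • ContinuousLinearMap.id ℝ ℝ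
  have hM : M.PosSemidef := by
    refine ((RKHS.posSemidef_tfae (K := M)).out 0 2).mpr (And.intro ?_ fun v => ?_)
    · ext x y
      simp [M, Matrix.conjTranspose_apply, hK.symm x x.2 y y.2, ContinuousLinearMap.star_eq_adjoint,
        ContinuousLinearMap.adjoint_id]
    · have := hK.nonneg v.support.card (fun i => ((v.support.equivFin.symm i : X) : E d))
        (fun i => v (v.support.equivFin.symm i)) (fun i => Subtype.coe_prop _)
      simp only [M, Finsupp.sum, RCLike.re_to_real]
      refine this.trans_eq ?_
      rw [← Finset.sum_coe_sort v.support, ← Equiv.sum_comp v.support.equivFin.symm]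
      refine Finset.sum_congr rfl fun i _ => ?_
      rw [← Finset.sum_coe_sort v.support, ← Equiv.sum_comp v.support.equivFin.symm]
      refine Finset.sum_congr rfl fun j _ => ?_
      have := hK.symm _ (v.support.equivFin.symm i : X).2 _ (v.support.equivFin.symm j : X).2
      simp [this]; ring
  have : Fact M.PosSemidef := ⟨hM⟩
  refine ⟨RKHS.OfKernel M, inferInstance, inferInstance, inferInstance,
    fun x => if hx : x ∈ X then RKHS.kerFun (RKHS.OfKernel M) ⟨x, hx⟩ 1 else 0, ?_⟩
  intro x hx y hy
  have := RKHS.kernel_inner (RKHS.OfKernel M) ⟨y, hy⟩ ⟨x, hx⟩ 1 1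
  rw [RKHS.OfKernel.kernel_ofKernel] at this
  simp only [hx, hy, dif_pos]
  rw [← this, hK.symm x hx y hy]
  simp [M]
end KRR

namespace KRR
variable {d : ℕ}

/-! ### Linearity and locality of iterated partial derivatives -/

/-- The `i`-th standard basis vector. -/
noncomputable abbrev ee (i : Fin d) : E d := EuclideanSpace.single i (1 : ℝ)

theorem norm_smul_ee (t : ℝ) (i : Fin d) : ‖t • ee i‖ = |t| := by
  simp [ee, norm_smul]

theorem iterPartial_append_singleton (l : List (Fin d)) (i : Fin d) (f : E d → ℝ) :
    iterPartial (l ++ [i]) f = iterPartial l (iterPartial [i] f) := by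
  induction l with
  | nil => rfl
  | cons j l ih => simp only [List.cons_append, iterPartial, ih]

theorem hasIterPartialOn_append_singleton {U : Set (E d)} {l : List (Fin d)} {i : Fin d}
    {f : E d → ℝ} : HasIterPartialOn U (l ++ [i]) f ↔
      (∀ x ∈ U, LineDifferentiableAt ℝ f x (ee i)) ∧
        HasIterPartialOn U l (iterPartial [i] f) := by
  induction l with
  | nil => simp [HasIterPartialOn, iterPartial]
  | cons j l ih =>
    simp only [List.cons_append, HasIterPartialOn, ih, iterPartial_append_singleton, and_assoc]

theorem eventually_line_mem {U : Set (E d)} (hU : IsOpen U) {x : E d} (hx : x ∈ U) (v : E d) :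
    ∀ᶠ t : ℝ in 𝓝 0, x + t • v ∈ U := by
  have : Tendsto (fun t : ℝ => x + t • v) (𝓝 0) (𝓝 (x + (0 : ℝ) • v)) :=
    (by fun_prop : Continuous fun t : ℝ => x + t • v).tendsto 0
  rw [zero_smul, add_zero] at this
  exact this (hU.mem_nhds hx)

theorem hasLineDerivAt_congr {U : Set (E d)} (hU : IsOpen U) {f g : E d → ℝ} (h : EqOn f g U)
    {x : E d} (hx : x ∈ U) {v : E d} {c : ℝ} (hf : HasLineDerivAt ℝ f c x v) :
    HasLineDerivAt ℝ g c x v :=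
  hf.congr_of_eventuallyEq (eventually_of_mem (hU.mem_nhds hx) fun _ hy => (h hy).symm)

theorem iterPartial_congr {U : Set (E d)} (hU : IsOpen U) {f g : E d → ℝ} (h : EqOn f g U)
    (l : List (Fin d)) : EqOn (iterPartial l f) (iterPartial l g) U := by
  induction l with
  | nil => exact h
  | cons i l ih =>
    intro x hx
    exact Filter.EventuallyEq.lineDeriv_eq (eventually_of_mem (hU.mem_nhds hx) ih)

theorem HasIterPartialOn.congr {U : Set (E d)} (hU : IsOpen U) {f g : E d → ℝ} (h : EqOn f g U)
    {l : List (Fin d)} (hf : HasIterPartialOn U l f) : HasIterPartialOn U l g := by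
  induction l with
  | nil => trivial
  | cons i l ih =>
    refine ⟨ih hf.1, fun x hx => ?_⟩
    exact (hasLineDerivAt_congr hU (iterPartial_congr hU h l) hx
      (hf.2 x hx).hasLineDerivAt).lineDifferentiableAt

/-- Existence and value are proved together: `lineDeriv` defaults to zero, so it is additive only
where the derivatives exist. -/
theorem HasIterPartialOn.sub {U : Set (E d)} (hU : IsOpen U) {f g : E d → ℝ} {l : List (Fin d)}
    (hf : HasIterPartialOn U l f) (hg : HasIterPartialOn U l g) :
    HasIterPartialOn U l (fun x => f x - g x) ∧
      EqOn (iterPartial l fun x => f x - g x) (fun x => iterPartial l f x - iterPartial l g x)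
        U := by
  induction l with
  | nil => exact ⟨trivial, fun x _ => rfl⟩
  | cons i l ih =>
    obtain ⟨h1, h2⟩ := ih hf.1 hg.1
    have key : ∀ x ∈ U, HasLineDerivAt ℝ (iterPartial l fun x => f x - g x)
        (iterPartial (i :: l) f x - iterPartial (i :: l) g x) x (ee i) := by
      intro x hx
      refine hasLineDerivAt_congr hU h2.symm hx ?_
      exact HasDerivAt.sub (hf.2 x hx).hasLineDerivAt (hg.2 x hx).hasLineDerivAt
    exact ⟨⟨h1, fun x hx => (key x hx).lineDifferentiableAt⟩, fun x hx => (key x hx).lineDeriv⟩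

/-! ### Iterated differences -/

/-- The iterated difference with steps `s`. -/
noncomputable def stepDiff {V : Type*} [AddCommGroup V] : List (Fin d × ℝ) → (E d → V) → E d → V
  | [], f => f
  | p :: s, f => fun x => stepDiff s f (x + p.2 • ee p.1) - stepDiff s f x

/-- The total length of a list of steps. -/
noncomputable def stepSize (s : List (Fin d × ℝ)) : ℝ := (s.map fun p => |p.2|).sum

/-- The product of the step lengths. -/
noncomputable def stepProd (s : List (Fin d × ℝ)) : ℝ := (s.map Prod.snd).prod

@[simp] theorem stepSize_nil : stepSize ([] : List (Fin d × ℝ)) = 0 := rfl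
@[simp] theorem stepSize_cons (p : Fin d × ℝ) (s : List (Fin d × ℝ)) :
    stepSize (p :: s) = |p.2| + stepSize s := by simp [stepSize]
@[simp] theorem stepProd_nil : stepProd ([] : List (Fin d × ℝ)) = 1 := rfl
@[simp] theorem stepProd_cons (p : Fin d × ℝ) (s : List (Fin d × ℝ)) :
    stepProd (p :: s) = p.2 * stepProd s := by simp [stepProd]
theorem stepSize_append (s t : List (Fin d × ℝ)) :
    stepSize (s ++ t) = stepSize s + stepSize t := by simp [stepSize]
theorem stepProd_append (s t : List (Fin d × ℝ)) :
    stepProd (s ++ t) = stepProd s * stepProd t := by simp [stepProd]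

theorem closedBall_step_subset (x : E d) (p : Fin d × ℝ) (r : ℝ) :
    Metric.closedBall (x + p.2 • ee p.1) r ⊆ Metric.closedBall x (|p.2| + r) := by
  refine Metric.closedBall_subset_closedBall' ?_
  rw [dist_eq_norm, add_sub_cancel_left, norm_smul_ee, add_comm]

section
variable {V W : Type*} [AddCommGroup V] [AddCommGroup W]

theorem stepDiff_congr {f g : E d → V} (s : List (Fin d × ℝ)) {x : E d}
    (h : EqOn f g (Metric.closedBall x (stepSize s))) : stepDiff s f x = stepDiff s g x := by
  induction s generalizing x with
  | nil => exact h (by simp)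
  | cons p s ih =>
    rw [stepSize_cons] at h
    simp only [stepDiff]
    rw [ih (h.mono (closedBall_step_subset x p _)),
      ih (h.mono (Metric.closedBall_subset_closedBall (by simp)))]

theorem stepDiff_map (L : V → W) (hL : ∀ a b, L (a - b) = L a - L b) (s : List (Fin d × ℝ))
    (f : E d → V) (x : E d) : stepDiff s (fun y => L (f y)) x = L (stepDiff s f x) := by
  induction s generalizing x with
  | nil => rfl
  | cons p s ih => simp only [stepDiff, ih, hL]

/-- Differences commute, so the innermost one can be taken outermost. -/
theorem stepDiff_append_singleton (s : List (Fin d × ℝ)) (p : Fin d × ℝ) (f : E d → V) (x : E d) :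
    stepDiff (s ++ [p]) f x = stepDiff s f (x + p.2 • ee p.1) - stepDiff s f x := by
  induction s generalizing x with
  | nil => rfl
  | cons q s ih =>
    simp only [List.cons_append, stepDiff, ih, add_right_comm x (q.2 • ee q.1)]
    abel
end

theorem hasLineDerivAt_stepDiff (s : List (Fin d × ℝ)) {f : E d → ℝ} (i : Fin d) {x : E d}
    (h : ∀ y ∈ Metric.closedBall x (stepSize s), LineDifferentiableAt ℝ f y (ee i)) :
    HasLineDerivAt ℝ (stepDiff s f) (stepDiff s (iterPartial [i] f) x) x (ee i) := by
  induction s generalizing x with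
  | nil => exact (h x (by simp)).hasLineDerivAt
  | cons p s ih =>
    rw [stepSize_cons] at h
    have h1 := ih fun y hy => h y (closedBall_step_subset x p _ hy)
    have h2 := ih fun y hy => h y (Metric.closedBall_subset_closedBall (by simp) hy)
    refine HasDerivAt.sub ?_ h2
    have h1' : HasDerivAt (fun t : ℝ => stepDiff s f (x + p.2 • ee p.1 + t • ee i)) _ 0 := h1
    simpa only [add_right_comm x (p.2 • ee p.1)] using h1'

/-- Mean value theorem for iterated differences. -/
theorem exists_stepDiff_eq {U : Set (E d)} (l : List (Fin d)) : ∀ (f : E d → ℝ) (x : E d)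
    (s : List (Fin d × ℝ)), s.map Prod.fst = l → Metric.closedBall x (stepSize s) ⊆ U →
    HasIterPartialOn U l f → ∃ ξ ∈ Metric.closedBall x (stepSize s),
      stepDiff s f x = stepProd s * iterPartial l f ξ := by
  -- The last index of the list is the derivative applied first to `f`. Moving the matching
  -- difference outermost turns it into an increment in one real variable, and the mean value
  -- theorem trades it for one derivative on `f`.
  induction l using List.reverseRecOn with
  | nil =>
    intro f x s hs _ _
    obtain rfl : s = [] := by simpa using hs
    exact ⟨x, by simp, by simp [stepDiff, iterPartial]⟩
  | append_singleton l i ih =>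
    intro f x s hs hU hf
    obtain ⟨s, t, rfl, hsl, ht⟩ := List.map_eq_append_iff.mp hs
    obtain ⟨⟨j, h⟩, rfl, hj⟩ : ∃ p, t = [p] ∧ p.1 = i := by
      obtain ⟨p, t', rfl, hp, ht'⟩ := List.map_eq_cons_iff.mp ht
      exact ⟨p, by simpa using ht', hp⟩
    obtain rfl : j = i := hj
    rw [hasIterPartialOn_append_singleton] at hf
    have hsz : stepSize (s ++ [(j, h)]) = |h| + stepSize s := by
      simp [stepSize_append, add_comm]
    rw [hsz] at hU ⊢
    have hsub : ∀ θ ∈ Icc (0 : ℝ) 1, Metric.closedBall (x + θ • h • ee j) (stepSize s) ⊆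
        Metric.closedBall x (|h| + stepSize s) := by
      intro θ hθ
      refine Metric.closedBall_subset_closedBall' ?_
      rw [dist_eq_norm, add_sub_cancel_left, smul_smul, norm_smul_ee, abs_mul, add_comm]
      have : |θ| * |h| ≤ 1 * |h| := by
        gcongr
        rw [abs_of_nonneg hθ.1]; exact hθ.2
      linarith
    have hder : ∀ θ ∈ Icc (0 : ℝ) 1, HasDerivAt (fun t : ℝ => stepDiff s f (x + t • h • ee j))
        (h * stepDiff s (iterPartial [j] f) (x + θ • h • ee j)) θ := by
      intro θ hθ
      have h1 := (hasLineDerivAt_stepDiff s (f := f) j (x := x + θ • h • ee j)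
        fun y hy => hf.1 y (hU (hsub θ hθ hy))).smul h
      have h2 : HasDerivAt (fun t : ℝ => stepDiff s f (x + θ • h • ee j + t • h • ee j))
        (h * stepDiff s (iterPartial [j] f) (x + θ • h • ee j)) (θ - θ) := by
        rw [sub_self]; exact h1
      have h3 := h2.comp_sub_const θ θ
      refine h3.congr_of_eventuallyEq (Eventually.of_forall fun t => ?_)
      simp only [sub_smul]
      congr 1
      abel
    obtain ⟨θ, hθ, hslope⟩ := exists_hasDerivAt_eq_slope
      (fun t : ℝ => stepDiff s f (x + t • h • ee j)) _ zero_lt_one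
      (fun t ht => (hder t ht).continuousAt.continuousWithinAt)
      (fun t ht => hder t (Ioo_subset_Icc_self ht))
    have hθ' := Ioo_subset_Icc_self hθ
    obtain ⟨ξ, hξ, hξ'⟩ := ih (iterPartial [j] f) (x + θ • h • ee j) s hsl
      ((hsub θ hθ').trans hU) hf.2
    refine ⟨ξ, hsub θ hθ' hξ, ?_⟩
    rw [stepDiff_append_singleton, iterPartial_append_singleton, stepProd_append]
    simp only [one_smul, zero_smul, add_zero, sub_zero, div_one, stepProd_cons, stepProd_nil]
      at hslope ⊢
    rw [← hslope, hξ']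
    ring

end KRR

namespace KRR
variable {d : ℕ}

/-! ### Strong derivatives of feature maps -/

/-- A double limit equals the iterated limit whenever the inner limits exist; closed neighbourhoods
survive the inner limit. -/
theorem tendsto_of_tendsto_prod {α β Y : Type*} [TopologicalSpace Y] [RegularSpace Y]
    {f : Filter α} {g : Filter β} [g.NeBot] {F : α → β → Y} {G : α → Y} {y : Y}
    (h : Tendsto (fun p : α × β => F p.1 p.2) (f ×ˢ g) (𝓝 y))
    (hG : ∀ᶠ a in f, Tendsto (F a) g (𝓝 (G a))) : Tendsto G f (𝓝 y) := by
  refine (closed_nhds_basis y).tendsto_right_iff.mpr fun V hV => ?_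
  filter_upwards [(h.eventually_mem hV.1).curry, hG] with a ha hGa
  exact hV.2.mem_of_tendsto hGa ha

section Hilbert
variable {H : Type*} [NormedAddCommGroup H] [InnerProductSpace ℝ H]

/-- Expanding `‖f a - f b‖²` gives inner products with the common limit `c`, and `c - 2c + c = 0`,
so `f` is Cauchy along `L`. -/
theorem exists_tendsto_of_tendsto_inner [CompleteSpace H] {α : Type*} {L : Filter α} [L.NeBot]
    {f : α → H} {c : ℝ}
    (h : Tendsto (fun p : α × α => inner ℝ (f p.1) (f p.2)) (L ×ˢ L) (𝓝 c)) :
    ∃ v, Tendsto f L (𝓝 v) := by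
  have h1 : Tendsto (fun p : α × α => inner ℝ (f p.1) (f p.1)) (L ×ˢ L) (𝓝 c) :=
    h.comp (tendsto_fst.prodMk tendsto_fst)
  have h2 : Tendsto (fun p : α × α => inner ℝ (f p.2) (f p.2)) (L ×ˢ L) (𝓝 c) :=
    h.comp (tendsto_snd.prodMk tendsto_snd)
  have h3 : Tendsto (fun p : α × α => dist (f p.1) (f p.2)) (L ×ˢ L) (𝓝 0) := by
    have h4 := Real.continuous_sqrt.continuousAt.tendsto.comp ((h1.sub (h.const_mul 2)).add h2)
    rw [show c - 2 * c + c = 0 by ring, Real.sqrt_zero] at h4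
    refine h4.congr fun p => ?_
    simp only [Function.comp]
    rw [real_inner_self_eq_norm_sq, real_inner_self_eq_norm_sq, ← norm_sub_sq_real, dist_eq_norm,
      Real.sqrt_sq (norm_nonneg _)]
  exact cauchy_iff_exists_le_nhds.mp (cauchy_map_iff.mpr
    ⟨inferInstance, tendsto_uniformity_iff_dist_tendsto_zero.mpr h3⟩)

/-- The filter of lists of nonzero steps in the directions `l`, tending to zero. -/
noncomputable def stepFilter : List (Fin d) → Filter (List (Fin d × ℝ))
  | [] => pure []
  | i :: l => map (fun p : ℝ × List (Fin d × ℝ) => (i, p.1) :: p.2) (𝓝[≠] 0 ×ˢ stepFilter l)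

instance stepFilter_neBot (l : List (Fin d)) : (stepFilter l).NeBot := by
  induction l with
  | nil => exact pure_neBot
  | cons i l ih => exact Filter.NeBot.map inferInstance _

theorem eventually_stepFilter (l : List (Fin d)) :
    ∀ᶠ s in stepFilter l, s.map Prod.fst = l ∧ stepProd s ≠ 0 := by
  induction l with
  | nil => simp [stepFilter]
  | cons i l ih =>
    rw [stepFilter, eventually_map]
    filter_upwards [tendsto_fst.eventually (eventually_mem_nhdsWithin (a := (0 : ℝ)) (s := {0}ᶜ)),
      tendsto_snd.eventually ih] with p hp hs
    have : p.1 ≠ 0 := hp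
    simp [hs.1, hs.2, this]

theorem tendsto_stepSize (l : List (Fin d)) : Tendsto stepSize (stepFilter l) (𝓝 0) := by
  induction l with
  | nil => simpa [stepFilter] using tendsto_pure_nhds stepSize ([] : List (Fin d × ℝ))
  | cons i l ih =>
    rw [stepFilter, tendsto_map'_iff]
    have h0 : Tendsto (fun t : ℝ => |t|) (𝓝[≠] 0) (𝓝 0) := by
      simpa using (continuous_abs.tendsto (0 : ℝ)).mono_left nhdsWithin_le_nhds
    simpa [Function.comp_def] using (h0.comp tendsto_fst).add (ih.comp tendsto_snd)

/-- The iterated difference quotient. -/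
noncomputable def diffQuot (f : E d → H) (x : E d) (s : List (Fin d × ℝ)) : H :=
  (stepProd s)⁻¹ • stepDiff s f x

theorem hasIterPartialOn_stepDiff {U : Set (E d)} (hU : IsOpen U) {K : E d → E d → ℝ}
    {l : List (Fin d)} (s : List (Fin d × ℝ)) {x : E d}
    (h : ∀ a ∈ Metric.closedBall x (stepSize s), HasIterPartialOn U l (K a)) :
    HasIterPartialOn U l (fun b => stepDiff s (fun a => K a b) x) ∧
      EqOn (iterPartial l fun b => stepDiff s (fun a => K a b) x)
        (fun b => stepDiff s (fun a => iterPartial l (K a) b) x) U := by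
  induction s generalizing x with
  | nil => exact ⟨h x (by simp), fun b _ => rfl⟩
  | cons p s ih =>
    rw [stepSize_cons] at h
    have h1 := ih fun y hy => h y (closedBall_step_subset x p _ hy)
    have h2 := ih fun y hy => h y (Metric.closedBall_subset_closedBall (by simp) hy)
    have h3 := h1.1.sub hU h2.1
    exact ⟨h3.1, fun b hb => (h3.2 hb).trans (by simp only [stepDiff, h1.2 hb, h2.2 hb])⟩

theorem inner_stepDiff {K : E d → E d → ℝ} {f : E d → H} {x y : E d} {s t : List (Fin d × ℝ)}
    (h : ∀ a ∈ Metric.closedBall x (stepSize s), ∀ b ∈ Metric.closedBall y (stepSize t),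
      inner ℝ (f a) (f b) = K a b) :
    inner ℝ (stepDiff s f x) (stepDiff t f y) =
      stepDiff t (fun b => stepDiff s (fun a => K a b) x) y := by
  rw [← stepDiff_map (fun v => inner ℝ (stepDiff s f x) v) (fun a b => inner_sub_right _ _ _)]
  refine stepDiff_congr t fun b hb => ?_
  rw [← stepDiff_map (fun v => inner ℝ v (f b)) (fun a b => inner_sub_left _ _ _)]
  exact stepDiff_congr s fun a ha => h a ha b hb

theorem exists_inner_diffQuot_eq {U : Set (E d)} (hU : IsOpen U) {K : E d → E d → ℝ}
    {f : E d → H} {l : List (Fin d)} (hf : ∀ x ∈ U, ∀ y ∈ U, inner ℝ (f x) (f y) = K x y)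
    (h1 : ∀ x ∈ U, HasIterPartialOn U l (K x))
    (h2 : ∀ y ∈ U, HasIterPartialOn U l fun x => iterPartial l (K x) y)
    {x y : E d} {s t : List (Fin d × ℝ)}
    (hs : s.map Prod.fst = l) (ht : t.map Prod.fst = l) (hs0 : stepProd s ≠ 0)
    (ht0 : stepProd t ≠ 0) (hx : Metric.closedBall x (stepSize s) ⊆ U)
    (hy : Metric.closedBall y (stepSize t) ⊆ U) :
    ∃ ξ ∈ Metric.closedBall x (stepSize s), ∃ η ∈ Metric.closedBall y (stepSize t),
      inner ℝ (diffQuot f x s) (diffQuot f y t) =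
        iterPartial l (fun a => iterPartial l (K a) η) ξ := by
  -- The mean value theorem is used in the second variable while the first is still differenced, and
  -- then in the first variable with `η` fixed.
  have h3 := hasIterPartialOn_stepDiff hU s fun a ha => h1 a (hx ha)
  obtain ⟨η, hη, hη'⟩ := exists_stepDiff_eq l _ y t ht hy h3.1
  obtain ⟨ξ, hξ, hξ'⟩ := exists_stepDiff_eq l _ x s hs hx (h2 η (hy hη))
  refine ⟨ξ, hξ, η, hη, ?_⟩
  rw [diffQuot, diffQuot, real_inner_smul_left, real_inner_smul_right,
    inner_stepDiff fun a ha b hb => hf a (hx ha) b (hy hb), hη', h3.2 (hy hη)]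
  simp only [hξ']
  field_simp

theorem tendsto_inner_diffQuot {U : Set (E d)} (hU : IsOpen U) {K : E d → E d → ℝ}
    {f : E d → H} {l : List (Fin d)} (hf : ∀ x ∈ U, ∀ y ∈ U, inner ℝ (f x) (f y) = K x y)
    (h1 : ∀ x ∈ U, HasIterPartialOn U l (K x))
    (h2 : ∀ y ∈ U, HasIterPartialOn U l fun x => iterPartial l (K x) y)
    (h3 : ContinuousOn (fun z : E d × E d => iterPartial l (fun a => iterPartial l (K a) z.2) z.1)
      (U ×ˢ U)) {x y : E d} (hx : x ∈ U) (hy : y ∈ U) :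
    Tendsto (fun p : List (Fin d × ℝ) × List (Fin d × ℝ) =>
      inner ℝ (diffQuot f x p.1) (diffQuot f y p.2)) (stepFilter l ×ˢ stepFilter l)
      (𝓝 (iterPartial l (fun a => iterPartial l (K a) y) x)) := by
  have hc := (h3.continuousAt (((hU.prod hU).mem_nhds (mk_mem_prod hx hy)))).tendsto
  refine Metric.tendsto_nhds.mpr fun ε hε => ?_
  obtain ⟨δ, hδ, hb⟩ := Metric.eventually_nhds_iff_ball.mp (Metric.tendsto_nhds.mp hc ε hε)
  obtain ⟨δ1, hδ1, hb1⟩ := Metric.isOpen_iff.mp hU x hx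
  obtain ⟨δ2, hδ2, hb2⟩ := Metric.isOpen_iff.mp hU y hy
  have hm : 0 < min δ (min δ1 δ2) := by positivity
  have hev : ∀ᶠ s in stepFilter l, (s.map Prod.fst = l ∧ stepProd s ≠ 0) ∧
      stepSize s < min δ (min δ1 δ2) :=
    (eventually_stepFilter l).and ((tendsto_stepSize l).eventually_lt_const hm)
  filter_upwards [tendsto_fst.eventually hev, tendsto_snd.eventually hev] with p ⟨hp, hp'⟩ ⟨hq, hq'⟩
  simp only [lt_min_iff] at hp' hq'
  obtain ⟨ξ, hξ, η, hη, he⟩ := exists_inner_diffQuot_eq hU hf h1 h2 hp.1 hq.1 hp.2 hq.2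
    ((Metric.closedBall_subset_ball hp'.2.1).trans hb1)
    ((Metric.closedBall_subset_ball hq'.2.2).trans hb2)
  rw [he]
  refine hb (ξ, η) ?_
  rw [← ball_prod_same]
  exact ⟨Metric.closedBall_subset_ball hp'.1 hξ, Metric.closedBall_subset_ball hq'.1 hη⟩

/-- A quotient for `i :: l` is a slope, in direction `i`, of quotients for `l`. Sending the inner
steps to zero first leaves the slope of `g`, which therefore has the joint limit `v`. -/
theorem hasDerivAt_of_tendsto_diffQuot {U : Set (E d)} (hU : IsOpen U) {f g : E d → H}
    {i : Fin d} {l : List (Fin d)} {v : H}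
    (hg : ∀ x ∈ U, Tendsto (diffQuot f x) (stepFilter l) (𝓝 (g x)))
    {x : E d} (hx : x ∈ U) (hv : Tendsto (diffQuot f x) (stepFilter (i :: l)) (𝓝 v)) :
    HasLineDerivAt ℝ g v x (ee i) := by
  rw [hasLineDerivAt_iff_tendsto_slope_zero]
  rw [stepFilter, tendsto_map'_iff] at hv
  refine tendsto_of_tendsto_prod (F := fun h s => h⁻¹ • (diffQuot f (x + h • ee i) s - diffQuot f x s))
    (hv.congr fun p => ?_) ?_
  · simp [diffQuot, stepDiff, smul_sub, smul_smul, mul_comm]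
  · filter_upwards [nhdsWithin_le_nhds (eventually_line_mem hU hx (ee i))] with h hh
    exact ((hg _ hh).sub (hg x hx)).const_smul _

theorem exists_tendsto_diffQuot [CompleteSpace H] {U : Set (E d)} (hU : IsOpen U)
    {K : E d → E d → ℝ} {f : E d → H} (hf : ∀ x ∈ U, ∀ y ∈ U, inner ℝ (f x) (f y) = K x y)
    {l : List (Fin d)} (h1 : ∀ x ∈ U, HasIterPartialOn U l (K x))
    (h2 : ∀ y ∈ U, HasIterPartialOn U l fun x => iterPartial l (K x) y)
    (h3 : ContinuousOn (fun z : E d × E d => iterPartial l (fun a => iterPartial l (K a) z.2) z.1)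
      (U ×ˢ U)) :
    ∃ g : E d → H, (∀ x ∈ U, Tendsto (diffQuot f x) (stepFilter l) (𝓝 (g x))) ∧
      ∀ x ∈ U, ∀ y ∈ U,
        inner ℝ (g x) (g y) = iterPartial l (fun a => iterPartial l (K a) y) x := by
  have hex : ∀ x, ∃ v, x ∈ U → Tendsto (diffQuot f x) (stepFilter l) (𝓝 v) := fun x => by
    by_cases hx : x ∈ U
    · obtain ⟨v, hv⟩ := exists_tendsto_of_tendsto_inner
        (tendsto_inner_diffQuot hU hf h1 h2 h3 hx hx)
      exact ⟨v, fun _ => hv⟩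
    · exact ⟨0, fun hx' => absurd hx' hx⟩
  choose g hg using hex
  refine ⟨g, hg, fun x hx y hy => ?_⟩
  exact tendsto_nhds_unique (((hg x hx).comp tendsto_fst).inner ((hg y hy).comp tendsto_snd))
    (tendsto_inner_diffQuot hU hf h1 h2 h3 hx hy)

/-- If the mixed derivatives of a kernel exist and are continuous, so do the strong derivatives of
its feature map, and their Gram kernel is the mixed derivative of the kernel. -/
theorem exists_iterPartial_feature [CompleteSpace H] {U : Set (E d)} (hU : IsOpen U)
    {K : E d → E d → ℝ} {f : E d → H} (hf : ∀ x ∈ U, ∀ y ∈ U, inner ℝ (f x) (f y) = K x y)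
    (l : List (Fin d))
    (h : ∀ l', l' <:+ l → (∀ x ∈ U, HasIterPartialOn U l' (K x)) ∧
      (∀ y ∈ U, HasIterPartialOn U l' fun x => iterPartial l' (K x) y) ∧
      ContinuousOn (fun z : E d × E d => iterPartial l' (fun a => iterPartial l' (K a) z.2) z.1)
        (U ×ˢ U)) :
    ∃ g : E d → H, (∀ x ∈ U, Tendsto (diffQuot f x) (stepFilter l) (𝓝 (g x))) ∧
      (∀ x ∈ U, ∀ y ∈ U,
        inner ℝ (g x) (g y) = iterPartial l (fun a => iterPartial l (K a) y) x) ∧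
      ∀ w, HasIterPartialOn U l (fun x => inner ℝ (f x) w) ∧
        EqOn (iterPartial l fun x => inner ℝ (f x) w) (fun x => inner ℝ (g x) w) U := by
  induction l with
  | nil =>
    refine ⟨f, fun x _ => ?_, hf, fun w => ⟨trivial, fun x _ => rfl⟩⟩
    have := tendsto_pure_nhds (diffQuot f x) ([] : List (Fin d × ℝ))
    simpa [stepFilter, diffQuot, stepDiff] using this
  | cons i l ih =>
    obtain ⟨g', hg', -, hw⟩ := ih fun l' hl' => h l' (hl'.trans (List.suffix_cons i l))
    obtain ⟨h1, h2, h3⟩ := h (i :: l) List.suffix_rfl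
    obtain ⟨g, hg, hgK⟩ := exists_tendsto_diffQuot hU hf h1 h2 h3
    refine ⟨g, hg, hgK, fun w => ?_⟩
    have key : ∀ x ∈ U, HasLineDerivAt ℝ (iterPartial l fun x => inner ℝ (f x) w)
        (inner ℝ (g x) w) x (ee i) := by
      intro x hx
      refine hasLineDerivAt_congr hU (hw w).2.symm hx ?_
      have h4 : HasDerivAt (fun t : ℝ => g' (x + t • ee i)) (g x) 0 :=
        hasDerivAt_of_tendsto_diffQuot hU hg' hx (hg x hx)
      have h5 := h4.inner ℝ (hasDerivAt_const (0 : ℝ) w)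
      rw [inner_zero_right, zero_add] at h5
      exact h5
    exact ⟨⟨(hw w).1, fun x hx => (key x hx).lineDifferentiableAt⟩,
      fun x hx => (key x hx).lineDeriv⟩

end Hilbert

/-! ### Suffixes of index lists -/

/-- The kernel hypotheses concern multi-indices, whereas the induction on a list of derivatives
passes through its suffixes; these are again lists of multi-indices, of no larger order. -/
theorem exists_of_suffix_flatMap_replicate (L : List (Fin d)) (hL : L.Nodup) (β : Fin d → ℕ)
    {l : List (Fin d)} (hl : l <:+ L.flatMap fun i => List.replicate (β i) i) :
    ∃ γ : Fin d → ℕ, γ ≤ β ∧ l = L.flatMap fun i => List.replicate (γ i) i := by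
  induction L generalizing l with
  | nil => exact ⟨β, le_rfl, by simpa using hl⟩
  | cons a L ih =>
    rw [List.nodup_cons] at hL
    have hupd : ∀ (γ : Fin d → ℕ) (n : ℕ), (L.flatMap fun i =>
        List.replicate (Function.update γ a n i) i) = L.flatMap fun i => List.replicate (γ i) i := by
      intro γ n
      refine List.flatMap_congr fun i hi => ?_
      rw [Function.update_of_ne]
      rintro rfl
      exact hL.1 hi
    rw [List.flatMap_cons] at hl
    obtain ⟨ws, hws⟩ := hl
    -- The suffix starts either within the block of copies of `a`, keeping `t.length` of them, or
    -- beyond it, keeping none.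
    obtain ⟨t, ht, rfl⟩ | ⟨t, -, ht⟩ := List.append_eq_append_iff.mp hws
    · obtain ⟨hn, ht'⟩ := List.suffix_replicate_iff.mp ⟨ws, ht.symm⟩
      refine ⟨Function.update β a t.length, ?_, ?_⟩
      · exact update_le_iff.mpr ⟨hn, fun i _ => le_rfl⟩
      · rw [List.flatMap_cons, hupd, Function.update_self, ← ht']
    · obtain ⟨γ, hγ, rfl⟩ := ih hL.2 ⟨t, ht.symm⟩
      refine ⟨Function.update γ a 0, ?_, ?_⟩
      · exact update_le_iff.mpr ⟨Nat.zero_le _, fun i _ => hγ i⟩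
      · simp [hupd]

theorem exists_of_suffix_indexList {β : Fin d → ℕ} {l : List (Fin d)} (hl : l <:+ indexList β) :
    ∃ γ : Fin d → ℕ, order γ ≤ order β ∧ l = indexList γ := by
  obtain ⟨γ, hγ, rfl⟩ := exists_of_suffix_flatMap_replicate _ (List.nodup_finRange d) β hl
  exact ⟨γ, Finset.sum_le_sum fun i _ => hγ i, rfl⟩

end KRR

/-! ### Regularity of the feature map up to the boundary -/

namespace KRR
variable {d : ℕ}

section Hilbert
variable {H : Type*} [NormedAddCommGroup H] [InnerProductSpace ℝ H]

theorem continuousOn_feature {X : Set (E d)} {K : E d → E d → ℝ} {Φ : E d → H}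
    (hΦ : ∀ x ∈ X, ∀ y ∈ X, inner ℝ (Φ x) (Φ y) = K x y)
    (hK : ContinuousOn (fun z : E d × E d => K z.1 z.2) (X ×ˢ X)) : ContinuousOn Φ X := by
  intro x hx
  have hsq : ContinuousOn (fun y => K y y - 2 * K y x + K x x) X := by
    have h1 : ContinuousOn (fun y => K y y) X :=
      hK.comp (f := fun y => (y, y)) (by fun_prop) fun y hy => mk_mem_prod hy hy
    have h2 : ContinuousOn (fun y => K y x) X :=
      hK.comp (f := fun y => (y, x)) (by fun_prop) fun y hy => mk_mem_prod hy hx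
    exact (h1.sub (h2.const_smul (2 : ℝ))).add continuousOn_const
  have h3 := Real.continuous_sqrt.continuousAt.tendsto.comp (hsq x hx).tendsto
  refine tendsto_iff_dist_tendsto_zero.mpr ?_
  have h4 : K x x - 2 * K x x + K x x = 0 := by ring
  simp only [h4, Real.sqrt_zero] at h3
  refine h3.congr' (eventually_of_mem self_mem_nhdsWithin fun y hy => ?_)
  simp only [Function.comp, ← hΦ y hy y hy, ← hΦ y hy x hx, ← hΦ x hx x hx]
  rw [real_inner_self_eq_norm_sq, real_inner_self_eq_norm_sq, ← norm_sub_sq_real, dist_eq_norm,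
    Real.sqrt_sq (norm_nonneg _)]

/-- The feature map of a `C^{2m}` kernel has strong partial derivatives up to order `m`, which
extend continuously to the boundary and are bounded by `κ_β`. -/
theorem IsC2m.exists_partial_feature [CompleteSpace H] {X : Set (E d)} (hX : IsCompact X)
    (hXint : X ⊆ closure (interior X)) {K : E d → E d → ℝ} {m : ℕ} (hK : IsC2m X m K)
    {Φ : E d → H} (hΦ : ∀ x ∈ X, ∀ y ∈ X, inner ℝ (Φ x) (Φ y) = K x y) {β : Fin d → ℕ}
    (hβ : order β ≤ m) :
    ∃ Ψ : E d → H, ContinuousOn Ψ X ∧ (∀ x ∈ X, ‖Ψ x‖ ≤ kappa X β K) ∧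
      ∀ (w : H) (F : E d → ℝ), EqOn F (fun x => inner ℝ (Φ x) w) X →
        HasMPartialOn (interior X) β F ∧
        EqOn (mpartial β F) (fun x => inner ℝ (Ψ x) w) (interior X) ∧
        EqOn (derivOn X β F) (fun x => inner ℝ (Ψ x) w) X := by
  have hU : IsOpen (interior X) := isOpen_interior
  have hUX : interior X ⊆ X := interior_subset
  obtain ⟨g, -, hgK, hgw⟩ := exists_iterPartial_feature hU
    (fun x hx y hy => hΦ x (hUX hx) y (hUX hy)) (indexList β) fun l' hl' => by
      obtain ⟨γ, hγ, rfl⟩ := exists_of_suffix_indexList hl'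
      obtain ⟨h1, h2, G, hG, hGe⟩ := hK.2 γ (hγ.trans hβ)
      exact ⟨h1, h2, (hG.mono (prod_mono hUX hUX)).congr fun z hz => (hGe hz).symm⟩
  obtain ⟨-, -, G, hG, hGe⟩ := hK.2 β hβ
  have hGg : ∀ x ∈ interior X, ∀ y ∈ interior X, inner ℝ (g x) (g y) = G (x, y) :=
    fun x hx y hy => (hgK x hx y hy).trans (hGe (mk_mem_prod hx hy)).symm
  -- The Gram kernel of `g` extends continuously to `X × X`, so `g` is Cauchy at every boundary
  -- point.
  have hlim : ∀ x ∈ X, ∃ v, Tendsto g (𝓝[interior X] x) (𝓝 v) := by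
    intro x hx
    have : (𝓝[interior X] x).NeBot := mem_closure_iff_nhdsWithin_neBot.mp (hXint hx)
    refine exists_tendsto_of_tendsto_inner (c := G (x, x)) ?_
    rw [← nhdsWithin_prod_eq]
    refine ((hG (x, x) (mk_mem_prod hx hx)).mono (prod_mono hUX hUX)).tendsto.congr' ?_
    exact eventually_of_mem self_mem_nhdsWithin fun z hz => (hGg _ hz.1 _ hz.2).symm
  have htend : ∀ x ∈ X, Tendsto g (𝓝[interior X] x) (𝓝 (extendFrom (interior X) g x)) :=
    fun x hx => tendsto_extendFrom (hlim x hx)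
  have hcont := continuousOn_extendFrom hXint hlim
  have hext : ∀ x ∈ interior X, extendFrom (interior X) g x = g x := fun x hx =>
    extendFrom_extends (fun y hy => by
      obtain ⟨v, hv⟩ := hlim y (hUX hy)
      have : v = g y := tendsto_nhds_unique (hv.mono_left (pure_le_nhdsWithin hy))
        (tendsto_pure_nhds g y)
      rw [this] at hv
      exact hv) x hx
  have hdiag : ∀ x ∈ X, derivOn₂ X β K (x, x) = ‖extendFrom (interior X) g x‖ ^ 2 := by
    intro x hx
    refine extendFrom_eq ?_ ?_
    · rw [closure_prod_eq]; exact mk_mem_prod (hXint hx) (hXint hx)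
    · rw [nhdsWithin_prod_eq, ← real_inner_self_eq_norm_sq]
      refine (((htend x hx).comp tendsto_fst).inner ((htend x hx).comp tendsto_snd)).congr' ?_
      rw [← nhdsWithin_prod_eq]
      exact eventually_of_mem self_mem_nhdsWithin fun z hz => hgK _ hz.1 _ hz.2
  refine ⟨extendFrom (interior X) g, hcont, fun x hx => ?_, fun w F hF => ?_⟩
  · refine Real.le_sqrt_of_sq_le ?_
    rw [← hdiag x hx]
    -- The real `sSup` of an unbounded set is `0`; compactness supplies the bound that makes `kappa`
    -- a genuine supremum.
    refine le_csSup ?_ (mem_image_of_mem _ hx)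
    have := (hX.image_of_continuousOn (hcont.norm.pow 2)).bddAbove
    rw [image_congr hdiag]
    exact this
  · have hF' : EqOn (fun x => inner ℝ (Φ x) w) F (interior X) := fun x hx => (hF (hUX hx)).symm
    have h1 : EqOn (mpartial β F) (fun x => inner ℝ (g x) w) (interior X) :=
      (iterPartial_congr hU hF' _).symm.trans (hgw w).2
    refine ⟨(hgw w).1.congr hU hF', fun x hx => ?_, fun x hx => ?_⟩
    · rw [h1 hx]; simp only [hext x hx]
    · refine extendFrom_eq (hXint hx) (((htend x hx).inner tendsto_const_nhds).congr' ?_)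
      exact eventually_of_mem self_mem_nhdsWithin fun z hz => (h1 hz).symm

theorem IsC2m.isCm_of_eqOn_inner [CompleteSpace H] {X : Set (E d)} (hX : IsCompact X)
    (hXint : X ⊆ closure (interior X)) {K : E d → E d → ℝ} {m : ℕ} (hK : IsC2m X m K)
    {Φ : E d → H} (hΦ : ∀ x ∈ X, ∀ y ∈ X, inner ℝ (Φ x) (Φ y) = K x y) {F : E d → ℝ} {w : H}
    (hF : EqOn F (fun x => inner ℝ (Φ x) w) X) : IsCm X m F := by
  refine ⟨((continuousOn_feature hΦ hK.1).inner continuousOn_const).congr hF, fun β hβ => ?_⟩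
  obtain ⟨Ψ, hΨ, -, h⟩ := hK.exists_partial_feature hX hXint hΦ hβ
  obtain ⟨h1, h2, -⟩ := h w F hF
  exact ⟨h1, _, hΨ.inner continuousOn_const, h2.symm⟩

end Hilbert

/-! ### The integral operator in terms of the feature map -/

section Integral
variable {X : Set (E d)} {P : Measure (E d)} {K : E d → E d → ℝ}
  {ev : ℕ → ℝ} {ψ : ℕ → E d → ℝ}

theorem ae_mem_of_compl_null (hPX : P Xᶜ = 0) : ∀ᵐ x ∂P, x ∈ X := by
  rw [ae_iff]; exact hPX

theorem memLp_of_continuousOn {F : Type*} [NormedAddCommGroup F] [IsFiniteMeasure P]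
    (hX : IsCompact X) (hPX : P Xᶜ = 0) {f : E d → F} (hf : ContinuousOn f X) (p : ENNReal) :
    MemLp f p P := by
  obtain ⟨C, hC⟩ := hX.exists_bound_of_continuousOn hf
  refine MemLp.of_bound ?_ C ((ae_mem_of_compl_null hPX).mono hC)
  have := hf.aestronglyMeasurable (μ := P) hX.measurableSet
  rwa [Measure.restrict_eq_self_of_ae_mem (ae_mem_of_compl_null hPX)] at this

/-- If `f x ≠ 0`, then `f` is nonzero on `X` near `x`, a set of positive mass. -/
theorem eqOn_zero_of_ae_zero (hPX : P Xᶜ = 0) (hPsupp : ∀ x ∈ X, ∀ U ∈ 𝓝 x, 0 < P U)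
    {f : E d → ℝ} (hf : ContinuousOn f X) (h0 : f =ᵐ[P] 0) : ∀ x ∈ X, f x = 0 := by
  intro x hx
  by_contra hne
  have h1 : {y | f y ≠ 0} ∈ 𝓝[X] x := (hf x hx).eventually_ne hne
  obtain ⟨U, hU, hUX⟩ := mem_nhdsWithin_iff_exists_mem_nhds_inter.mp h1
  refine (hPsupp x hx U hU).ne' (measure_mono_null (t := Xᶜ ∪ {y | f y ≠ 0}) ?_ ?_)
  · intro y hy
    by_cases hyX : y ∈ X
    · exact Or.inr (hUX ⟨hy, hyX⟩)
    · exact Or.inl hyX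
  · exact measure_union_null hPX (ae_iff.mp h0)

theorem l2inner_sub {f g h : E d → ℝ} (hf : MemLp f 2 P) (hg : MemLp g 2 P) (hh : MemLp h 2 P) :
    l2inner P (fun x => f x - g x) h = l2inner P f h - l2inner P g h := by
  simp only [l2inner, sub_mul]
  exact integral_sub (hf.integrable_mul hh) (hg.integrable_mul hh)

theorem l2inner_congr (hPX : P Xᶜ = 0) {f g h : E d → ℝ} (hfg : EqOn f g X) :
    l2inner P f h = l2inner P g h :=
  integral_congr_ae ((ae_mem_of_compl_null hPX).mono fun x hx => by simp only [hfg hx])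

/-- A continuous function is determined on `X` by its coefficients in the eigenbasis. -/
theorem IsEigenSystem.eqOn_of_l2inner_eq [IsFiniteMeasure P] (hψ : IsEigenSystem X P K ev ψ)
    (hX : IsCompact X) (hPX : P Xᶜ = 0) (hPsupp : ∀ x ∈ X, ∀ U ∈ 𝓝 x, 0 < P U)
    {f g : E d → ℝ} (hf : ContinuousOn f X) (hg : ContinuousOn g X)
    (h : ∀ i, l2inner P f (ψ i) = l2inner P g (ψ i)) : EqOn f g X := by
  have hf2 := memLp_of_continuousOn hX hPX hf 2
  have hg2 := memLp_of_continuousOn hX hPX hg 2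
  intro x hx
  refine sub_eq_zero.mp (eqOn_zero_of_ae_zero hPX hPsupp (hf.sub hg) ?_ x hx)
  refine hψ.complete _ (hf2.sub hg2) fun i => ?_
  exact (l2inner_sub hf2 hg2 (hψ.memLp i)).trans (sub_eq_zero.mpr (h i))

/-- Bessel's inequality for the eigenfunctions. -/
theorem IsEigenSystem.bessel (hψ : IsEigenSystem X P K ev ψ) {g : E d → ℝ} (hg : MemLp g 2 P) :
    Summable (fun i => l2inner P g (ψ i) ^ 2) ∧
      ∑' i, l2inner P g (ψ i) ^ 2 ≤ (eLpNorm g 2 P).toReal ^ 2 := by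
  have hin : ∀ {f h : E d → ℝ} (hf : MemLp f 2 P) (hh : MemLp h 2 P),
      inner ℝ (hf.toLp f) (hh.toLp h) = l2inner P h f := by
    intro f h hf hh
    rw [L2.inner_def]
    refine integral_congr_ae ?_
    filter_upwards [hf.coeFn_toLp, hh.coeFn_toLp] with x h1 h2
    rw [h1, h2]; simp
  have ho : Orthonormal ℝ fun i => (hψ.memLp i).toLp (ψ i) := by
    classical
    rw [orthonormal_iff_ite]
    intro i j
    rw [hin, hψ.orthonormal j i]
    simp only [eq_comm]
  have h1 := ho.inner_products_summable (x := hg.toLp g)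
  have h2 := ho.tsum_inner_products_le (x := hg.toLp g)
  simp only [hin, Real.norm_eq_abs, sq_abs, Lp.norm_toLp] at h1 h2
  exact ⟨h1, h2⟩

variable {H : Type*} [NormedAddCommGroup H] [InnerProductSpace ℝ H]

/-- Square summable coefficients with respect to an orthonormal sequence are realized. -/
theorem exists_inner_eq_of_summable_sq [CompleteSpace H] {u : ℕ → H} (hu : Orthonormal ℝ u)
    {b : ℕ → ℝ} (hb : Summable fun i => b i ^ 2) :
    ∃ w : H, (∀ i, inner ℝ (u i) w = b i) ∧ ‖w‖ ^ 2 = ∑' i, b i ^ 2 := by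
  have hmem : Memℓp b 2 := memℓp_gen (by simpa using hb)
  let b' : lp (fun _ : ℕ => ℝ) 2 := ⟨b, hmem⟩
  refine ⟨hu.orthogonalFamily.linearIsometry b', fun i => ?_, ?_⟩
  · have h1 := hu.orthogonalFamily.hasSum_linearIsometry b'
    have h2 := h1.mapL (innerSL ℝ (u i))
    refine h2.unique ?_
    have h3 : ∀ j, innerSL ℝ (u i) (LinearIsometry.toSpanSingleton ℝ H (hu.1 j) (b' j)) =
        if j = i then b i else 0 := by
      intro j
      rw [innerSL_apply_apply, LinearIsometry.toSpanSingleton_apply, real_inner_smul_right,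
        orthonormal_iff_ite.mp hu i j]
      by_cases hij : i = j
      · subst hij; simp [b']
      · simp [hij, Ne.symm hij]
    simp only [h3]
    exact hasSum_ite_eq i (b i)
  · rw [LinearIsometry.norm_map]
    have := lp.norm_rpow_eq_tsum (p := 2) (by simp) b'
    simpa [b'] using this

/-- The adjoint of the evaluation map `w ↦ ⟨Φ ·, w⟩` into `L²(P)`. -/
noncomputable def synth (P : Measure (E d)) (Φ : E d → H) (f : E d → ℝ) : H := ∫ y, f y • Φ y ∂P

section
variable [CompleteSpace H] [IsFiniteMeasure P] {Φ : E d → H}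

theorem inner_synth (hX : IsCompact X) (hPX : P Xᶜ = 0) (hΦc : ContinuousOn Φ X)
    {f : E d → ℝ} (hf : MemLp f 2 P) (w : H) :
    inner ℝ (synth P Φ f) w = ∫ y, f y * inner ℝ (Φ y) w ∂P := by
  have hint : Integrable (fun y => f y • Φ y) P := by
    rw [← memLp_one_iff_integrable]
    exact (memLp_of_continuousOn hX hPX hΦc 2).smul hf
  rw [synth, real_inner_comm, ← integral_inner hint]
  simp only [real_inner_smul_right, real_inner_comm]

theorem intOp_eq_inner_synth (hX : IsCompact X) (hPX : P Xᶜ = 0) (hΦc : ContinuousOn Φ X)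
    (hΦ : ∀ x ∈ X, ∀ y ∈ X, inner ℝ (Φ x) (Φ y) = K x y) {f : E d → ℝ} (hf : MemLp f 2 P) :
    EqOn (intOp P K f) (fun x => inner ℝ (Φ x) (synth P Φ f)) X := by
  intro x hx
  simp only
  rw [real_inner_comm, inner_synth hX hPX hΦc hf, intOp]
  refine integral_congr_ae ((ae_mem_of_compl_null hPX).mono fun y hy => ?_)
  simp only
  rw [real_inner_comm, hΦ x hx y hy, mul_comm]

theorem l2inner_feature (hX : IsCompact X) (hPX : P Xᶜ = 0) (hΦc : ContinuousOn Φ X)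
    (hψ : IsEigenSystem X P K ev ψ) (w : H) (i : ℕ) :
    l2inner P (fun x => inner ℝ (Φ x) w) (ψ i) = inner ℝ (synth P Φ (ψ i)) w := by
  rw [inner_synth hX hPX hΦc (hψ.memLp i), l2inner]
  simp only [mul_comm]

/-- The eigenvalue equation says `⟨Φ y, synth ψ_i⟩ = μ_i ψ_i(y)`. With `f = ψ_j` this makes the
`synth ψ_i` orthogonal with squared norms `μ_i`. -/
theorem inner_synth_synth (hX : IsCompact X) (hPX : P Xᶜ = 0) (hΦc : ContinuousOn Φ X)
    (hΦ : ∀ x ∈ X, ∀ y ∈ X, inner ℝ (Φ x) (Φ y) = K x y) (hψ : IsEigenSystem X P K ev ψ)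
    {f : E d → ℝ} (hf : MemLp f 2 P) (i : ℕ) :
    inner ℝ (synth P Φ f) (synth P Φ (ψ i)) = ev i * l2inner P f (ψ i) := by
  rw [inner_synth hX hPX hΦc hf, l2inner, ← integral_const_mul]
  refine integral_congr_ae ((ae_mem_of_compl_null hPX).mono fun y hy => ?_)
  have h1 := (intOp_eq_inner_synth hX hPX hΦc hΦ (hψ.memLp i) hy).symm.trans (hψ.eigen i y hy)
  simp only at h1 ⊢
  rw [h1]; ring

theorem l2inner_intOp (hX : IsCompact X) (hPX : P Xᶜ = 0) (hΦc : ContinuousOn Φ X)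
    (hΦ : ∀ x ∈ X, ∀ y ∈ X, inner ℝ (Φ x) (Φ y) = K x y) (hψ : IsEigenSystem X P K ev ψ)
    {f : E d → ℝ} (hf : MemLp f 2 P) (i : ℕ) :
    l2inner P (intOp P K f) (ψ i) = ev i * l2inner P f (ψ i) := by
  rw [l2inner_congr hPX (intOp_eq_inner_synth hX hPX hΦc hΦ hf), l2inner_feature hX hPX hΦc hψ,
    real_inner_comm, inner_synth_synth hX hPX hΦc hΦ hψ hf]

/-- Every function with suitably decaying coefficients lies in the range of the feature map. -/
theorem exists_feature_coeff (hX : IsCompact X) (hPX : P Xᶜ = 0) (hΦc : ContinuousOn Φ X)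
    (hΦ : ∀ x ∈ X, ∀ y ∈ X, inner ℝ (Φ x) (Φ y) = K x y) (hψ : IsEigenSystem X P K ev ψ)
    {b : ℕ → ℝ} (hb : Summable fun i => b i ^ 2) :
    ∃ w : H, (∀ i, l2inner P (fun x => inner ℝ (Φ x) w) (ψ i) = Real.sqrt (ev i) * b i) ∧
      ‖w‖ ^ 2 = ∑' i, b i ^ 2 := by
  have hpos : ∀ i, 0 < Real.sqrt (ev i) := fun i => Real.sqrt_pos.mpr (hψ.pos i)
  have hu : Orthonormal ℝ fun i => (Real.sqrt (ev i))⁻¹ • synth P Φ (ψ i) := by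
    classical
    rw [orthonormal_iff_ite]
    intro i j
    rw [real_inner_smul_left, real_inner_smul_right,
      inner_synth_synth hX hPX hΦc hΦ hψ (hψ.memLp i), hψ.orthonormal]
    split_ifs with hij
    · subst hij
      have := Real.mul_self_sqrt (hψ.pos i).le
      have h0 := (hpos i).ne'
      field_simp
      rw [sq, this]
    · simp
  obtain ⟨w, hw, hn⟩ := exists_inner_eq_of_summable_sq hu hb
  refine ⟨w, fun i => ?_, hn⟩
  rw [l2inner_feature hX hPX hΦc hψ, ← hw i, real_inner_smul_left,
    mul_inv_cancel_left₀ (hpos i).ne']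

theorem IsRegularized.l2inner_eq (hX : IsCompact X) (hPX : P Xᶜ = 0) (hΦc : ContinuousOn Φ X)
    (hΦ : ∀ x ∈ X, ∀ y ∈ X, inner ℝ (Φ x) (Φ y) = K x y) (hψ : IsEigenSystem X P K ev ψ)
    {f₀ F : E d → ℝ} (hf₀ : MemLp f₀ 2 P) {lam : ℝ} (hlam : 0 < lam)
    (hF : IsRegularized X P K lam f₀ F) (i : ℕ) :
    l2inner P F (ψ i) = ev i / (ev i + lam) * l2inner P f₀ (ψ i) := by
  have h1 : l2inner P (fun x => intOp P K f₀ x - intOp P K F x) (ψ i) =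
      lam * l2inner P F (ψ i) := by
    rw [l2inner, l2inner, ← integral_const_mul]
    refine integral_congr_ae ((ae_mem_of_compl_null hPX).mono fun y hy => ?_)
    simp only [← hF.2 y hy]
    ring
  have hm : ∀ {f : E d → ℝ}, MemLp f 2 P → MemLp (intOp P K f) 2 P := fun hf =>
    memLp_of_continuousOn hX hPX
      ((hΦc.inner continuousOn_const).congr (intOp_eq_inner_synth hX hPX hΦc hΦ hf)) 2
  rw [l2inner_sub (hm hf₀) (hm hF.1) (hψ.memLp i), l2inner_intOp hX hPX hΦc hΦ hψ hf₀,
    l2inner_intOp hX hPX hΦc hΦ hψ hF.1] at h1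
  have := hψ.pos i
  field_simp
  linarith

/-- Solving the defining equation for `F` expresses it through images of `L_K`, so a merely square
integrable `F` acquires the smoothness of the kernel. -/
theorem IsRegularized.eqOn_inner (hX : IsCompact X) (hPX : P Xᶜ = 0) (hΦc : ContinuousOn Φ X)
    (hΦ : ∀ x ∈ X, ∀ y ∈ X, inner ℝ (Φ x) (Φ y) = K x y)
    {f₀ F : E d → ℝ} (hf₀ : MemLp f₀ 2 P) {lam : ℝ} (hlam : 0 < lam)
    (hF : IsRegularized X P K lam f₀ F) :
    EqOn F (fun x => inner ℝ (Φ x) (lam⁻¹ • (synth P Φ f₀ - synth P Φ F))) X := by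
  intro x hx
  have h1 := hF.2 x hx
  rw [intOp_eq_inner_synth hX hPX hΦc hΦ hF.1 hx, intOp_eq_inner_synth hX hPX hΦc hΦ hf₀ hx] at h1
  simp only [real_inner_smul_right, inner_sub_right] at h1 ⊢
  rw [← h1]
  field_simp
  ring

theorem exists_isRegularized (hX : IsCompact X) (hPX : P Xᶜ = 0)
    (hPsupp : ∀ x ∈ X, ∀ U ∈ 𝓝 x, 0 < P U) (hΦc : ContinuousOn Φ X)
    (hΦ : ∀ x ∈ X, ∀ y ∈ X, inner ℝ (Φ x) (Φ y) = K x y) (hψ : IsEigenSystem X P K ev ψ)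
    {f₀ : E d → ℝ} (hf₀ : MemLp f₀ 2 P) {lam : ℝ} (hlam : 0 < lam) :
    ∃ F, IsRegularized X P K lam f₀ F := by
  -- The solution must have coefficients `μ_i/(μ_i + λ) · f_i = √μ_i · b_i`, which dictates `b_i`.
  -- Since `λ μ_i ≤ (μ_i + λ)²`, one has `b_i² ≤ λ⁻¹ f_i²`.
  have hsum : Summable fun i =>
      (Real.sqrt (ev i) / (ev i + lam) * l2inner P f₀ (ψ i)) ^ 2 := by
    refine Summable.of_nonneg_of_le (fun i => sq_nonneg _) (fun i => ?_)
      ((hψ.bessel hf₀).1.mul_left lam⁻¹)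
    have := hψ.pos i
    rw [mul_pow, div_pow, Real.sq_sqrt this.le]
    refine mul_le_mul_of_nonneg_right ?_ (sq_nonneg _)
    rw [div_le_iff₀ (by positivity), inv_mul_eq_div, le_div_iff₀ hlam]
    nlinarith [sq_nonneg (ev i), sq_nonneg lam, mul_pos this hlam]
  obtain ⟨w, hw, -⟩ := exists_feature_coeff hX hPX hΦc hΦ hψ hsum
  have hFc : ContinuousOn (fun x => inner ℝ (Φ x) w) X := hΦc.inner continuousOn_const
  have hF := memLp_of_continuousOn hX hPX hFc 2
  have hI : ∀ {f : E d → ℝ}, MemLp f 2 P → ContinuousOn (intOp P K f) X := fun hf =>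
    (hΦc.inner continuousOn_const).congr (intOp_eq_inner_synth hX hPX hΦc hΦ hf)
  have h2 : ∀ {f : E d → ℝ}, MemLp f 2 P → MemLp (intOp P K f) 2 P := fun hf =>
    memLp_of_continuousOn hX hPX (hI hf) 2
  refine ⟨fun x => inner ℝ (Φ x) w, hF, fun x hx => ?_⟩
  have key : EqOn (fun x => intOp P K f₀ x - intOp P K (fun x => inner ℝ (Φ x) w) x)
      (fun x => lam * inner ℝ (Φ x) w) X := by
    refine hψ.eqOn_of_l2inner_eq hX hPX hPsupp ((hI hf₀).sub (hI hF)) (hFc.const_smul lam)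
      fun i => ?_
    rw [l2inner_sub (h2 hf₀) (h2 hF) (hψ.memLp i), l2inner_intOp hX hPX hΦc hΦ hψ hf₀,
      l2inner_intOp hX hPX hΦc hΦ hψ hF]
    have : l2inner P (fun x => lam * inner ℝ (Φ x) w) (ψ i) =
        lam * l2inner P (fun x => inner ℝ (Φ x) w) (ψ i) := by
      simp only [l2inner, mul_assoc, integral_const_mul]
    rw [this, hw]
    have h3 := hψ.pos i
    have h4 := Real.mul_self_sqrt h3.le
    have h5 : Real.sqrt (ev i) * (Real.sqrt (ev i) / (ev i + lam) * l2inner P f₀ (ψ i)) =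
        ev i / (ev i + lam) * l2inner P f₀ (ψ i) := by
      rw [← mul_assoc, ← mul_div_assoc, h4]
    rw [h5]
    field_simp
    ring
  have := key hx
  simp only at this ⊢
  linarith

/-- Weighted AM-GM gives `λ^(1-r) μ^r ≤ (1-r)λ + rμ ≤ μ + λ`; multiply by `λ^r`. -/
theorem mul_rpow_div_add_le {lam mu r : ℝ} (hlam : 0 < lam) (hmu : 0 < mu) (h0 : 0 ≤ r)
    (h1 : r ≤ 1) : lam * mu ^ r / (mu + lam) ≤ lam ^ r := by
  have h2 := Real.geom_mean_le_arith_mean2_weighted (sub_nonneg.mpr h1) h0 hlam.le hmu.le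
    (by ring)
  have h3 : lam ^ r * lam ^ (1 - r) = lam := by
    rw [← Real.rpow_add hlam]; simp
  rw [div_le_iff₀ (by positivity)]
  calc lam * mu ^ r = lam ^ r * (lam ^ (1 - r) * mu ^ r) := by rw [← mul_assoc, h3]
    _ ≤ lam ^ r * ((1 - r) * lam + r * mu) := by gcongr
    _ ≤ lam ^ r * (mu + lam) := by
      have h4 := mul_nonneg h0 hlam.le
      have h5 := mul_nonneg (sub_nonneg.mpr h1) hmu.le
      exact mul_le_mul_of_nonneg_left (by linarith) (Real.rpow_nonneg hlam.le r)

end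
end Integral
end KRR

/-! ### The error bound in the reproducing kernel Hilbert space -/

namespace KRR
variable {d : ℕ} {X : Set (E d)} {P : Measure (E d)} {K : E d → E d → ℝ}
  {ev : ℕ → ℝ} {ψ : ℕ → E d → ℝ} {H : Type*} [NormedAddCommGroup H] [InnerProductSpace ℝ H]
  [CompleteSpace H] {Φ : E d → H}

theorem supNorm_le {f : E d → ℝ} {C : ℝ} (h : ∀ x ∈ X, |f x| ≤ C) :
    supNorm X f ≤ ENNReal.ofReal C :=
  iSup₂_le fun x hx => by
    rw [Real.enorm_eq_ofReal_abs]
    exact ENNReal.ofReal_le_ofReal (h x hx)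

theorem IsRegularized.l2inner_sub_eq [IsFiniteMeasure P] (hX : IsCompact X) (hPX : P Xᶜ = 0)
    (hΦc : ContinuousOn Φ X)
    (hΦ : ∀ x ∈ X, ∀ y ∈ X, inner ℝ (Φ x) (Φ y) = K x y) (hψ : IsEigenSystem X P K ev ψ)
    {f₀ F : E d → ℝ} (hf₀ : MemLp f₀ 2 P) {lam : ℝ} (hlam : 0 < lam)
    (hF : IsRegularized X P K lam f₀ F) (i : ℕ) :
    l2inner P (fun x => F x - f₀ x) (ψ i) = -(lam / (ev i + lam)) * l2inner P f₀ (ψ i) := by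
  rw [l2inner_sub hF.1 hf₀ (hψ.memLp i), hF.l2inner_eq hX hPX hΦc hΦ hψ hf₀ hlam]
  have := hψ.pos i
  field_simp
  ring

/-- Under the source condition `L_K^{-r-1/2} f₀ ∈ L²`, the error of the regularized function is
small in the reproducing kernel Hilbert space. -/
theorem IsRegularized.exists_sub_eq_inner [IsFiniteMeasure P] (hX : IsCompact X)
    (hPX : P Xᶜ = 0) (hPsupp : ∀ x ∈ X, ∀ U ∈ 𝓝 x, 0 < P U) (hΦc : ContinuousOn Φ X)
    (hΦ : ∀ x ∈ X, ∀ y ∈ X, inner ℝ (Φ x) (Φ y) = K x y) (hψ : IsEigenSystem X P K ev ψ)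
    {f₀ F g : E d → ℝ} (hf₀ : ContinuousOn f₀ X) {lam r : ℝ} (hlam : 0 < lam) (hr0 : 0 ≤ r)
    (hr1 : r ≤ 1) (hg : IsPow P ev ψ (-r - 1 / 2) f₀ g) (hF : IsRegularized X P K lam f₀ F) :
    ∃ w : H, EqOn (fun x => F x - f₀ x) (fun x => inner ℝ (Φ x) w) X ∧
      ‖w‖ ≤ lam ^ r * (eLpNorm g 2 P).toReal := by
  have hf₂ := memLp_of_continuousOn hX hPX hf₀ 2
  -- Since `f_i = μ_i^(r+1/2) g_i`, the error coefficient is `√μ_i` times the number squared here.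
  -- The factor `√μ_i` is the one that `exists_feature_coeff` provides.
  have hle : ∀ i, (-(lam * ev i ^ r / (ev i + lam)) * l2inner P g (ψ i)) ^ 2 ≤
      (lam ^ r) ^ 2 * l2inner P g (ψ i) ^ 2 := by
    intro i
    have := hψ.pos i
    rw [mul_pow, neg_sq]
    refine mul_le_mul_of_nonneg_right ?_ (sq_nonneg _)
    exact pow_le_pow_left₀ (by positivity) (mul_rpow_div_add_le hlam this hr0 hr1) 2
  obtain ⟨hs, hb⟩ := hψ.bessel hg.1
  have hsum := Summable.of_nonneg_of_le (fun i => sq_nonneg _) hle (hs.mul_left _)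
  obtain ⟨w, hw, hn⟩ := exists_feature_coeff hX hPX hΦc hΦ hψ hsum
  refine ⟨w, hψ.eqOn_of_l2inner_eq hX hPX hPsupp ?_ (hΦc.inner continuousOn_const) fun i => ?_, ?_⟩
  · exact (((hΦc.inner continuousOn_const).congr
      (hF.eqOn_inner hX hPX hΦc hΦ hf₂ hlam))).sub hf₀
  · rw [hF.l2inner_sub_eq hX hPX hΦc hΦ hψ hf₂ hlam, hw, hg.2, Real.sqrt_eq_rpow]
    have h0 := hψ.pos i
    have h1 : ev i ^ (1 / 2 : ℝ) * ev i ^ r * ev i ^ (-r - 1 / 2) = 1 := by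
      rw [← Real.rpow_add h0, ← Real.rpow_add h0]
      ring_nf
      exact Real.rpow_zero _
    calc -(lam / (ev i + lam)) * l2inner P f₀ (ψ i) =
        -(lam / (ev i + lam)) * l2inner P f₀ (ψ i) *
          (ev i ^ (1 / 2 : ℝ) * ev i ^ r * ev i ^ (-r - 1 / 2)) := by rw [h1, mul_one]
      _ = _ := by ring
  · refine abs_le_of_sq_le_sq' ?_ (by positivity) |>.2
    rw [hn, mul_pow]
    refine (hsum.tsum_le_tsum hle (hs.mul_left _)).trans ?_
    rw [tsum_mul_left]
    exact mul_le_mul_of_nonneg_left hb (sq_nonneg _)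

theorem IsRegularized.supNorm_derivOn_sub_le [IsFiniteMeasure P] (hX : IsCompact X)
    (hXint : X ⊆ closure (interior X)) (hPX : P Xᶜ = 0)
    (hPsupp : ∀ x ∈ X, ∀ U ∈ 𝓝 x, 0 < P U) {m : ℕ} (hK : IsC2m X m K)
    (hΦ : ∀ x ∈ X, ∀ y ∈ X, inner ℝ (Φ x) (Φ y) = K x y) (hψ : IsEigenSystem X P K ev ψ)
    {β : Fin d → ℕ} (hβ : order β ≤ m)
    {f₀ F g : E d → ℝ} (hf₀ : ContinuousOn f₀ X) {lam r : ℝ} (hlam : 0 < lam) (hr0 : 0 ≤ r)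
    (hr1 : r ≤ 1) (hg : IsPow P ev ψ (-r - 1 / 2) f₀ g) (hF : IsRegularized X P K lam f₀ F) :
    supNorm X (fun x => derivOn X β F x - derivOn X β f₀ x) ≤
      ENNReal.ofReal (kappa X β K * lam ^ r * (eLpNorm g 2 P).toReal) := by
  have hΦc := continuousOn_feature hΦ hK.1
  obtain ⟨w, hw, hn⟩ := hF.exists_sub_eq_inner hX hPX hPsupp hΦc hΦ hψ hf₀ hlam hr0 hr1 hg
  have hFw := hF.eqOn_inner hX hPX hΦc hΦ (memLp_of_continuousOn hX hPX hf₀ 2) hlam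
  obtain ⟨Ψ, -, hΨ, h⟩ := hK.exists_partial_feature hX hXint hΦ hβ
  refine supNorm_le fun x hx => ?_
  -- Both `F` and `F - f₀` are represented by vectors of `H`, hence so is `f₀`. The two derivatives
  -- then differ by `⟨Ψ x, w⟩`.
  rw [(h _ F hFw).2.2 hx, (h (lam⁻¹ • (synth P Φ f₀ - synth P Φ F) - w) f₀ fun y hy => ?_).2.2 hx]
  · simp only
    rw [← inner_sub_right, sub_sub_cancel, mul_assoc]
    refine (abs_real_inner_le_norm _ _).trans ?_
    exact mul_le_mul (hΨ x hx) hn (norm_nonneg _) (Real.sqrt_nonneg _)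
  · have h1 := hFw hy
    have h2 := hw hy
    simp only [inner_sub_right] at h1 h2 ⊢
    rw [← h1, ← h2]
    ring

end KRR

namespace KRR
variable {d : ℕ}

/-! ### Fourier modes on the unit cube -/

theorem isCompact_cube : IsCompact (cube d) := by
  have h : cube d = (WithLp.toLp 2 : (Fin d → ℝ) → E d) '' Icc 0 1 := by
    ext x
    simp only [cube, mem_ofPred_eq, mem_image]
    constructor
    · intro hx
      exact ⟨WithLp.ofLp x, ⟨fun i => (hx i).1, fun i => (hx i).2⟩, rfl⟩
    · rintro ⟨y, hy, rfl⟩ i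
      exact ⟨hy.1 i, hy.2 i⟩
  rw [h]
  exact isCompact_Icc.image (PiLp.continuous_toLp 2 _)

/-- The integral over the unit cube of a partial derivative of a periodic function vanishes. -/
theorem setIntegral_cube_fderiv_eq_zero {u : E d → ℝ} (hu : ContDiff ℝ 1 u) (j : Fin d)
    (hper : ∀ x, u (x + ee j) = u x) : ∫ x in cube d, fderiv ℝ u x (ee j) = 0 := by
  obtain _ | n := d
  · exact j.elim0
  let T : (Fin (n + 1) → ℝ) ≃L[ℝ] E (n + 1) := (EuclideanSpace.equiv (Fin (n + 1)) ℝ).symm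
  have hT : ∀ x, T x = WithLp.toLp 2 x := fun _ => rfl
  have hpre : WithLp.toLp 2 ⁻¹' cube (n + 1) = (Icc 0 1 : Set (Fin (n + 1) → ℝ)) := by
    ext x
    simp [cube, Pi.le_def, forall_and]
  have hTe : T (Pi.single j 1) = ee j := by
    rw [hT]; rfl
  have htrans : ∫ x in cube (n + 1), fderiv ℝ u x (ee j) =
      ∫ x in (Icc 0 1 : Set (Fin (n + 1) → ℝ)), fderiv ℝ u (T x) (ee j) := by
    rw [← hpre]
    exact ((PiLp.volume_preserving_toLp (Fin (n + 1))).setIntegral_preimage_emb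
      (MeasurableEquiv.toLp 2 _).measurableEmbedding (fun x => fderiv ℝ u x (ee j)) _).symm
  have hdc : Continuous fun x => fderiv ℝ u (T x) (ee j) := by
    have h1 := hu.continuous_fderiv one_ne_zero
    exact (h1.comp T.continuous).clm_apply continuous_const
  have hder : ∀ x, HasFDerivAt (fun x => u (T x)) ((fderiv ℝ u (T x)).comp (T : _ →L[ℝ] _)) x :=
    fun x => ((hu.differentiable one_ne_zero) (T x)).hasFDerivAt.comp x T.hasFDerivAt
  have hsum : ∀ x, ∑ i, (if i = j then (fderiv ℝ u (T x)).comp (T : _ →L[ℝ] _) else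
      (0 : (Fin (n + 1) → ℝ) →L[ℝ] ℝ)) (Pi.single i (1 : ℝ)) = fderiv ℝ u (T x) (ee j) := by
    intro x
    rw [Finset.sum_eq_single j]
    · simp [hTe]
    · intro i _ hi; simp [hi]
    · simp
  -- Divergence theorem for the field with `u` in direction `j` and zero elsewhere; periodicity
  -- cancels the two faces orthogonal to `j`.
  have key := integral_divergence_of_hasFDerivAt_off_countable' (0 : Fin (n + 1) → ℝ) 1
    (fun i => zero_le_one) (fun i x => if i = j then u (T x) else 0)
    (fun i x => if i = j then (fderiv ℝ u (T x)).comp (T : _ →L[ℝ] _) else 0) ∅ countable_empty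
    (fun i => by
      by_cases hi : i = j
      · simp only [hi, if_true]; exact (hu.continuous.comp T.continuous).continuousOn
      · simp only [hi, if_false]; exact continuousOn_const)
    (fun x _ i => by
      by_cases hi : i = j
      · simp only [hi, if_true]; exact hder x
      · simp only [hi, if_false]; exact hasFDerivAt_const _ _)
    (by
      simp only [hsum]
      exact hdc.continuousOn.integrableOn_compact isCompact_Icc)
  simp only [hsum] at key
  rw [htrans, key, Finset.sum_eq_single j]
  · rw [sub_eq_zero]
    simp only [if_true]
    congr 1
    funext x
    rw [eq_comm, ← hper, ← hTe, ← map_add]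
    congr 2
    ext i
    refine Fin.succAboveCases j ?_ (fun i => ?_) i
    · simp
    · simp
  · intro i _ hi; simp [hi]
  · simp

/-- The plane wave `cos (2π k · x + θ)`. -/
noncomputable def wave (k : Fin d → ℤ) (θ : ℝ) (x : E d) : ℝ := Real.cos (phase k x + θ)

theorem abs_wave_le (k : Fin d → ℤ) (θ : ℝ) (x : E d) : |wave k θ x| ≤ 1 := Real.abs_cos_le_one _

theorem contDiff_phase (k : Fin d → ℤ) {n : WithTop ℕ∞} : ContDiff ℝ n (phase k) := by
  unfold phase
  fun_prop

theorem contDiff_wave (k : Fin d → ℤ) (θ : ℝ) {n : WithTop ℕ∞} : ContDiff ℝ n (wave k θ) :=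
  Real.contDiff_cos.comp ((contDiff_phase k).add contDiff_const)

theorem phase_add_smul_ee (k : Fin d → ℤ) (x : E d) (t : ℝ) (j : Fin d) :
    phase k (x + t • ee j) = phase k x + 2 * Real.pi * k j * t := by
  have : ∀ i, (k i : ℝ) * (x + t • ee j) i = k i * x i + if i = j then k j * t else 0 := by
    intro i
    by_cases h : i = j
    · subst h; simp [ee]; ring
    · simp [ee, h]
  simp only [phase, this, Finset.sum_add_distrib, Finset.sum_ite_eq', Finset.mem_univ, if_true]
  ring

theorem wave_add_ee (k : Fin d → ℤ) (θ : ℝ) (x : E d) (j : Fin d) :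
    wave k θ (x + ee j) = wave k θ x := by
  have := phase_add_smul_ee k x 1 j
  rw [one_smul] at this
  rw [wave, wave, this, ← Real.cos_add_int_mul_two_pi (phase k x + θ) (k j)]
  ring_nf

/-- Differentiation only shifts the phase by `π/2`, so waves of arbitrary phase treat sines and
cosines at once. -/
theorem hasLineDerivAt_wave (k : Fin d → ℤ) (θ : ℝ) (x : E d) (j : Fin d) :
    HasLineDerivAt ℝ (wave k θ) (2 * Real.pi * k j * wave k (θ + Real.pi / 2) x) x (ee j) := by
  have h1 : HasDerivAt (fun t : ℝ => phase k x + 2 * Real.pi * k j * t + θ)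
      (2 * Real.pi * k j) 0 := by
    simpa using (((hasDerivAt_id (0 : ℝ)).const_mul (2 * Real.pi * k j)).const_add
      (phase k x)).add_const θ
  have h2 := h1.cos
  have h3 : ∀ t : ℝ, wave k θ (x + t • ee j) =
      Real.cos (phase k x + 2 * Real.pi * k j * t + θ) := fun t => by
    rw [wave, phase_add_smul_ee]
  refine (h2.congr_of_eventuallyEq (Eventually.of_forall h3)).congr_deriv ?_
  rw [wave, ← add_assoc, Real.cos_add_pi_div_two]
  simp
  ring

/-- The Fourier coefficients of a `C^n` function on the torus decay like `|k_j|^{-n}`. -/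
theorem IsPeriodicCp.exists_decay (j : Fin d) (n : ℕ) : ∀ g : E d → ℝ, IsPeriodicCp n g →
    ∃ M : ℝ, ∀ (k : Fin d → ℤ) (θ : ℝ),
      |(k j : ℝ)| ^ n * |∫ x in cube d, g x * wave k θ x| ≤ M := by
  induction n with
  | zero =>
    intro g hg
    refine ⟨∫ x in cube d, |g x|, fun k θ => ?_⟩
    rw [pow_zero, one_mul]
    refine abs_integral_le_integral_abs.trans (integral_mono_of_nonneg
      (Eventually.of_forall fun x => abs_nonneg _) ?_ (Eventually.of_forall fun x => ?_))
    · exact (hg.1.continuous.abs.continuousOn).integrableOn_compact isCompact_cube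
    · simp only [abs_mul]
      exact mul_le_of_le_one_right (abs_nonneg _) (abs_wave_le k θ x)
  | succ n ih =>
    intro g hg
    have hg1 : ContDiff ℝ 1 g := hg.1.of_le (by exact_mod_cast Nat.le_add_left 1 n)
    have hg' : IsPeriodicCp n (fun x => fderiv ℝ g x (ee j)) := by
      refine ⟨(hg.1.fderiv_right (m := n) (by exact_mod_cast le_rfl)).clm_apply contDiff_const,
        fun i x => ?_⟩
      have : (fun y => g (y + ee i)) = g := funext fun y => hg.2 i y
      have h2 := fderiv_comp_add_right (𝕜 := ℝ) (f := g) (x := x) (ee i)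
      rw [this] at h2
      exact congrArg (fun L : E d →L[ℝ] ℝ => L (ee j)) h2.symm
    obtain ⟨M, hM⟩ := ih _ hg'
    refine ⟨M, fun k θ => ?_⟩
    -- Integration by parts with the phase moved back by `π/2`, so that differentiating the wave
    -- returns phase `θ` and a factor `2πk_j`; the surplus `2π ≥ 1` is discarded.
    refine le_trans ?_ (hM k (θ - Real.pi / 2))
    rw [pow_succ, mul_assoc]
    refine mul_le_mul_of_nonneg_left ?_ (by positivity)
    have hw1 : ContDiff ℝ 1 (wave k (θ - Real.pi / 2)) := contDiff_wave _ _
    have h0 := setIntegral_cube_fderiv_eq_zero (hg1.mul hw1) j fun x => by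
      simp only [hg.2 j x, wave_add_ee, ee]
    have hder : ∀ x, fderiv ℝ (fun x => g x * wave k (θ - Real.pi / 2) x) x (ee j) =
        fderiv ℝ g x (ee j) * wave k (θ - Real.pi / 2) x +
          2 * Real.pi * k j * (g x * wave k θ x) := by
      intro x
      have hgd := hg1.differentiable one_ne_zero x
      have hwd := hw1.differentiable one_ne_zero x
      rw [fderiv_fun_mul hgd hwd]
      have h1 := (hasLineDerivAt_wave k (θ - Real.pi / 2) x j).lineDeriv
      rw [hwd.lineDeriv_eq_fderiv, sub_add_cancel] at h1
      simp [h1]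
      ring
    have hi1 : Integrable (fun x => fderiv ℝ g x (ee j) * wave k (θ - Real.pi / 2) x)
        (volume.restrict (cube d)) :=
      (hg'.1.continuous.mul hw1.continuous).continuousOn.integrableOn_compact isCompact_cube
    have hi2 : Integrable (fun x => g x * wave k θ x) (volume.restrict (cube d)) :=
      (hg1.continuous.mul (contDiff_wave (n := 1) k θ).continuous).continuousOn.integrableOn_compact
        isCompact_cube
    have h0' : ∫ x in cube d, fderiv ℝ (fun x => g x * wave k (θ - Real.pi / 2) x) x (ee j) = 0 :=
      h0
    simp only [hder] at h0'
    rw [integral_add hi1 (hi2.const_mul _), integral_const_mul] at h0'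
    rw [eq_neg_of_add_eq_zero_left h0', abs_neg, abs_mul, abs_mul, abs_of_pos Real.two_pi_pos]
    refine mul_le_mul_of_nonneg_right ?_ (abs_nonneg _)
    exact le_mul_of_one_le_left (abs_nonneg _) (by nlinarith [Real.pi_gt_three])

theorem abs_coe_le_norm (k : Fin d → ℤ) (j : Fin d) : |(k j : ℝ)| ≤ ‖k‖ := by
  rw [← Int.norm_eq_abs]
  exact norm_le_pi_norm k j

/-- The decay in a coordinate with `|k_j| = ‖k‖` is combined with the trivial order-zero bound
through `(1 + t)^n ≤ 2^(n-1) (1 + t^n)`. -/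
theorem IsPeriodicCp.exists_decay_norm (hd : 1 ≤ d) {n : ℕ} {g : E d → ℝ}
    (hg : IsPeriodicCp n g) : ∃ M : ℝ, 0 ≤ M ∧ ∀ (k : Fin d → ℤ) (θ : ℝ),
      |∫ x in cube d, g x * wave k θ x| ≤ M / (1 + ‖k‖) ^ n := by
  have : Nonempty (Fin d) := ⟨⟨0, hd⟩⟩
  choose M hM using fun j => IsPeriodicCp.exists_decay j n g hg
  obtain ⟨M0, hM0⟩ := IsPeriodicCp.exists_decay (Classical.arbitrary (Fin d)) 0 g
    ⟨hg.1.of_le (by exact_mod_cast Nat.zero_le n), hg.2⟩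
  have hMnn : ∀ j, 0 ≤ M j := fun j => le_trans (by positivity) (hM j 0 0)
  have hM0nn : 0 ≤ M0 := le_trans (by positivity) (hM0 0 0)
  have hS : 0 ≤ ∑ j, M j := Finset.sum_nonneg fun j _ => hMnn j
  refine ⟨2 ^ (n - 1) * (M0 + ∑ j, M j), by positivity, fun k θ => ?_⟩
  have hk : 0 < (1 + ‖k‖) ^ n := by positivity
  rw [le_div_iff₀ hk]
  obtain ⟨j, hj⟩ : ∃ j, ‖k j‖ = ‖k‖ := by
    obtain ⟨j, hj⟩ := Finite.exists_max fun j => ‖k j‖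
    exact ⟨j, le_antisymm (norm_le_pi_norm k j) ((pi_norm_le_iff_of_nonempty k).mpr hj)⟩
  have h1 := hM j k θ
  have h2 := hM0 k θ
  rw [← Int.norm_eq_abs, hj] at h1
  rw [pow_zero, one_mul] at h2
  have h3 : (1 + ‖k‖) ^ n ≤ 2 ^ (n - 1) * (1 + ‖k‖ ^ n) := by
    simpa using add_pow_le zero_le_one (norm_nonneg k) n
  have h4 : M j ≤ ∑ j, M j := Finset.single_le_sum (fun j _ => hMnn j) (Finset.mem_univ j)
  calc _ ≤ |∫ x in cube d, g x * wave k θ x| * (2 ^ (n - 1) * (1 + ‖k‖ ^ n)) := by gcongr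
    _ = 2 ^ (n - 1) * (|∫ x in cube d, g x * wave k θ x| +
        ‖k‖ ^ n * |∫ x in cube d, g x * wave k θ x|) := by ring
    _ ≤ _ := by gcongr; linarith

theorem summable_inv_one_add_norm_pow {n : ℕ} (hn : d < n) :
    Summable fun k : Fin d → ℤ => ((1 + ‖k‖) ^ n)⁻¹ := by
  let b := Pi.basisFun ℝ (Fin d)
  let L := Submodule.span ℤ (Set.range b)
  have hrank : Module.finrank ℤ L = d := by
    rw [ZLattice.rank ℝ L]; simp
  have h1 := ZLattice.summable_norm_pow_inv L n (by rw [hrank]; exact hn)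
  have hmem : ∀ k : Fin d → ℤ, (fun i => (k i : ℝ)) ∈ L := fun k => by
    rw [b.mem_span_iff_repr_mem ℤ]
    intro i
    exact ⟨k i, by simp [b]⟩
  have hinj : Function.Injective fun k : Fin d → ℤ => (⟨_, hmem k⟩ : L) := by
    intro k k' h
    funext i
    have : (k i : ℝ) = k' i := congrFun (congrArg Subtype.val h) i
    exact_mod_cast this
  have h2 := h1.comp_injective hinj
  -- In the lattice sum the term at `0` is `0⁻¹ ^ n = 0`, so the value `1` needed at `k = 0` is
  -- added separately.
  have h3 : Summable fun k : Fin d → ℤ => if k = 0 then (1 : ℝ) else 0 :=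
    (hasSum_ite_eq 0 1).summable
  refine Summable.of_nonneg_of_le (fun k => by positivity) (fun k => ?_) (h2.add h3)
  have hnorm : ‖(⟨_, hmem k⟩ : L)‖ = ‖k‖ := by
    rw [Submodule.coe_norm]
    simp only [Pi.norm_def]
    rfl
  simp only [Function.comp, hnorm]
  by_cases hk : k = 0
  · subst hk; simp
  · have : 0 < ‖k‖ := norm_pos_iff.mpr hk
    rw [if_neg hk, add_zero, inv_pow]
    gcongr
    linarith

end KRR

namespace KRR
variable {d : ℕ}

/-! ### Fourier series and their derivatives -/

theorem hasDerivAt_wave_line (k : Fin d → ℤ) (θ : ℝ) (x : E d) (j : Fin d) (y : ℝ) :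
    HasDerivAt (fun t : ℝ => wave k θ (x + t • ee j))
      (2 * Real.pi * k j * wave k (θ + Real.pi / 2) (x + y • ee j)) y := by
  have h1 : HasDerivAt (fun t : ℝ => wave k θ (x + y • ee j + t • ee j))
      (2 * Real.pi * k j * wave k (θ + Real.pi / 2) (x + y • ee j)) (y - y) := by
    rw [sub_self]; exact hasLineDerivAt_wave k θ (x + y • ee j) j
  refine (h1.comp_sub_const y y).congr_of_eventuallyEq (Eventually.of_forall fun t => ?_)
  simp only [sub_smul]
  congr 1
  abel

theorem abs_two_pi_mul_le (k : Fin d → ℤ) (j : Fin d) :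
    |2 * Real.pi * k j| ≤ 2 * Real.pi * (1 + ‖k‖) := by
  rw [abs_mul, abs_of_pos Real.two_pi_pos]
  have := abs_coe_le_norm k j
  exact mul_le_mul_of_nonneg_left (by linarith) Real.two_pi_pos.le

theorem abs_prod_two_pi_le (k : Fin d → ℤ) (l : List (Fin d)) :
    |(l.map fun j => 2 * Real.pi * (k j : ℝ)).prod| ≤ (2 * Real.pi * (1 + ‖k‖)) ^ l.length := by
  induction l with
  | nil => simp
  | cons j l ih =>
    rw [List.map_cons, List.prod_cons, abs_mul, List.length_cons, pow_succ']
    exact mul_le_mul (abs_two_pi_mul_le k j) ih (abs_nonneg _)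
      (by have := Real.two_pi_pos; positivity)

theorem one_le_two_pi_mul (k : Fin d → ℤ) : 1 ≤ 2 * Real.pi * (1 + ‖k‖) := by
  have := Real.pi_gt_three
  have := norm_nonneg k
  nlinarith

/-- Termwise differentiation under a uniform majorant. The base `2π(1 + ‖k‖)` is at least `1`, so
the top-order majorant controls all lower orders. -/
theorem iterPartial_tsum_wave {a : ℕ → ℝ} {k : ℕ → Fin d → ℤ} {θ : ℕ → ℝ} (l : List (Fin d))
    (h : Summable fun i => |a i| * (2 * Real.pi * (1 + ‖k i‖)) ^ l.length) :
    iterPartial l (fun x => ∑' i, a i * wave (k i) (θ i) x) = fun x => ∑' i, a i *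
      (l.map fun j => 2 * Real.pi * (k i j : ℝ)).prod *
        wave (k i) (θ i + l.length * (Real.pi / 2)) x := by
  induction l with
  | nil => simp [iterPartial]
  | cons j l ih =>
    have h' : Summable fun i => |a i| * (2 * Real.pi * (1 + ‖k i‖)) ^ l.length := by
      refine Summable.of_nonneg_of_le (fun i => ?_) (fun i => ?_) h
      · have := one_le_two_pi_mul (k i); positivity
      · exact mul_le_mul_of_nonneg_left (pow_le_pow_right₀ (one_le_two_pi_mul (k i)) (by simp))
          (abs_nonneg _)
    have hb : ∀ (l : List (Fin d)) i (θ : ℝ) (x : E d), ‖a i *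
        (l.map fun j => 2 * Real.pi * (k i j : ℝ)).prod * wave (k i) θ x‖ ≤
          |a i| * (2 * Real.pi * (1 + ‖k i‖)) ^ l.length := by
      intro l i θ x
      rw [Real.norm_eq_abs, abs_mul, abs_mul]
      exact (mul_le_of_le_one_right (by positivity) (abs_wave_le _ _ _)).trans
        (mul_le_mul_of_nonneg_left (abs_prod_two_pi_le (k i) l) (abs_nonneg _))
    funext x
    rw [iterPartial, ih h']
    have key := hasDerivAt_tsum (𝕜 := ℝ) (y₀ := 0) h
      (g := fun i t => a i * (l.map fun j => 2 * Real.pi * (k i j : ℝ)).prod *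
        wave (k i) (θ i + l.length * (Real.pi / 2)) (x + t • ee j))
      (g' := fun i t => a i * ((j :: l).map fun j => 2 * Real.pi * (k i j : ℝ)).prod *
        wave (k i) (θ i + l.length * (Real.pi / 2) + Real.pi / 2) (x + t • ee j))
      (fun i y => by
        refine ((hasDerivAt_wave_line (k i) _ x j y).const_mul _).congr_deriv ?_
        simp only [List.map_cons, List.prod_cons]
        ring)
      (fun i y => hb (j :: l) i _ _)
      (Summable.of_norm_bounded h' fun i => hb l i _ _) 0
    refine (HasDerivAt.deriv key).trans (tsum_congr fun i => ?_)
    rw [zero_smul, add_zero, List.length_cons]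
    push_cast
    ring_nf

theorem length_indexList (β : Fin d → ℕ) : (indexList β).length = order β := by
  simp [indexList, order, List.length_flatMap, Fin.sum_univ_def]

theorem abs_mpartial_tsum_wave_le {a : ℕ → ℝ} {k : ℕ → Fin d → ℤ} {θ : ℕ → ℝ} (β : Fin d → ℕ)
    {u : ℕ → ℝ} (hu : Summable u)
    (h : ∀ i, |a i| * (2 * Real.pi * (1 + ‖k i‖)) ^ order β ≤ u i) (x : E d) :
    |mpartial β (fun x => ∑' i, a i * wave (k i) (θ i) x) x| ≤ ∑' i, u i := by
  rw [← length_indexList] at h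
  have hs : Summable fun i => |a i| * (2 * Real.pi * (1 + ‖k i‖)) ^ (indexList β).length := by
    refine Summable.of_nonneg_of_le (fun i => ?_) h hu
    have := one_le_two_pi_mul (k i); positivity
  rw [mpartial, iterPartial_tsum_wave _ hs, ← Real.norm_eq_abs]
  refine tsum_of_norm_bounded hu.hasSum fun i => (le_trans ?_ (h i))
  rw [Real.norm_eq_abs, abs_mul, abs_mul]
  exact (mul_le_of_le_one_right (by positivity) (abs_wave_le _ _ _)).trans
    (mul_le_mul_of_nonneg_left (abs_prod_two_pi_le (k i) _) (abs_nonneg _))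

theorem continuous_tsum_wave {a : ℕ → ℝ} {k : ℕ → Fin d → ℤ} {θ : ℕ → ℝ}
    (h : Summable fun i => |a i|) : Continuous fun x => ∑' i, a i * wave (k i) (θ i) x := by
  refine continuous_tsum (fun i => (contDiff_wave (n := 0) _ _).continuous.const_mul _) h
    fun i x => ?_
  rw [Real.norm_eq_abs, abs_mul]
  exact mul_le_of_le_one_right (abs_nonneg _) (abs_wave_le _ _ _)

/-! ### The normalised real Fourier system -/

/-- The normalising constant of the Fourier modes of frequency `k`. -/
noncomputable def modeConst (k : Fin d → ℤ) : ℝ := if k = 0 then 1 else Real.sqrt 2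

/-- The phase shift that turns a cosine into a sine. -/
noncomputable def modeShift (b : Bool) : ℝ := if b then -(Real.pi / 2) else 0

theorem abs_modeConst_le (k : Fin d → ℤ) : |modeConst k| ≤ Real.sqrt 2 := by
  unfold modeConst
  split_ifs
  · rw [abs_one]; exact Real.one_le_sqrt.mpr one_le_two
  · rw [abs_of_nonneg (Real.sqrt_nonneg _)]

theorem IsFourierFunction.exists_mode {φ : E d → ℝ} (h : IsFourierFunction φ) :
    ∃ q : (Fin d → ℤ) × Bool, ∀ x ∈ cube d, φ x = modeConst q.1 * wave q.1 (modeShift q.2) x := by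
  obtain h | ⟨k, hk, h | h⟩ := h
  · exact ⟨(0, false), fun x hx => by simp [h x hx, modeConst, wave, modeShift, phase]⟩
  · exact ⟨(k, false), fun x hx => by simp [h x hx, modeConst, wave, modeShift, hk]⟩
  · exact ⟨(k, true), fun x hx => by
      simp [h x hx, modeConst, wave, modeShift, hk, ← sub_eq_add_neg, Real.cos_sub_pi_div_two]⟩

theorem summable_mode {n : ℕ} (hn : d < n) :
    Summable fun q : (Fin d → ℤ) × Bool => ((1 + ‖q.1‖) ^ n)⁻¹ := by
  have h := (summable_inv_one_add_norm_pow hn).mul_of_nonneg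
    (Summable.of_finite (f := fun _ : Bool => (1 : ℝ))) (fun k => by positivity)
    (fun _ => zero_le_one)
  simpa using h

variable {P : Measure (E d)} {K : E d → E d → ℝ} {ev : ℕ → ℝ} {ψ : ℕ → E d → ℝ}
  {q : ℕ → (Fin d → ℤ) × Bool}

/-- Eigenfunctions sharing a mode coincide on the cube, against orthonormality. Injectivity lets
sums over `i` be dominated by sums over frequencies. -/
theorem IsEigenSystem.injective_mode (hP : P (cube d)ᶜ = 0) (hψ : IsEigenSystem (cube d) P K ev ψ)
    (hq : ∀ i, ∀ x ∈ cube d, ψ i x = modeConst (q i).1 * wave (q i).1 (modeShift (q i).2) x) :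
    Function.Injective q := by
  intro i j hij
  by_contra hne
  have h1 : l2inner P (ψ i) (ψ j) = l2inner P (ψ j) (ψ j) :=
    l2inner_congr hP fun x hx => by rw [hq i x hx, hq j x hx, hij]
  rw [hψ.orthonormal, hψ.orthonormal, if_neg hne, if_pos rfl] at h1
  exact zero_ne_one h1

theorem abs_l2inner_mode_le {g : E d → ℝ} {p : ℕ} {M : ℝ}
    (hM : ∀ (k : Fin d → ℤ) (θ : ℝ),
      |∫ x in cube d, g x * wave k θ x| ≤ M / (1 + ‖k‖) ^ p)
    {φ : E d → ℝ} {k : Fin d → ℤ} {θ : ℝ} (hφ : ∀ x ∈ cube d, φ x = modeConst k * wave k θ x) :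
    |l2inner (volume.restrict (cube d)) g φ| ≤ Real.sqrt 2 * (M / (1 + ‖k‖) ^ p) := by
  have h1 : l2inner (volume.restrict (cube d)) g φ =
      modeConst k * ∫ x in cube d, g x * wave k θ x := by
    rw [l2inner, ← integral_const_mul]
    refine setIntegral_congr_fun isCompact_cube.measurableSet fun x hx => ?_
    simp only [hφ x hx]
    ring
  rw [h1, abs_mul]
  exact mul_le_mul (abs_modeConst_le k) (hM k θ) (abs_nonneg _) (Real.sqrt_nonneg _)

/-- Absolute summability permits exchanging sum and integral; orthonormality keeps one term. -/
theorem IsEigenSystem.l2inner_tsum_mode [IsFiniteMeasure P] (hP : P (cube d)ᶜ = 0)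
    (hψ : IsEigenSystem (cube d) P K ev ψ)
    (hq : ∀ i, ∀ x ∈ cube d, ψ i x = modeConst (q i).1 * wave (q i).1 (modeShift (q i).2) x)
    {c : ℕ → ℝ} (hc : Summable fun i => |c i * modeConst (q i).1|) (j : ℕ) :
    l2inner P (fun x => ∑' i, c i * modeConst (q i).1 * wave (q i).1 (modeShift (q i).2) x) (ψ j) =
      c j := by
  have hw : ∀ i, MemLp (wave (q i).1 (modeShift (q i).2)) 2 P := fun i =>
    memLp_of_continuousOn isCompact_cube hP (contDiff_wave (n := 0) _ _).continuous.continuousOn 2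
  have hint : ∀ i, Integrable
      (fun x => c i * modeConst (q i).1 * wave (q i).1 (modeShift (q i).2) x * ψ j x) P := fun i =>
    ((hw i).const_mul (c i * modeConst (q i).1)).integrable_mul (hψ.memLp j)
  have hψ1 : Integrable (fun x => |ψ j x|) P :=
    ((hψ.memLp j).integrable one_le_two).abs
  have hsum : Summable fun i => ∫ x, ‖c i * modeConst (q i).1 *
      wave (q i).1 (modeShift (q i).2) x * ψ j x‖ ∂P := by
    refine Summable.of_nonneg_of_le (fun i => integral_nonneg fun x => norm_nonneg _) (fun i => ?_)
      (hc.mul_right (∫ x, |ψ j x| ∂P))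
    rw [← integral_const_mul]
    refine integral_mono (hint i).norm (hψ1.const_mul _) fun x => ?_
    simp only [Real.norm_eq_abs]
    rw [abs_mul, abs_mul]
    exact mul_le_mul_of_nonneg_right
      (mul_le_of_le_one_right (abs_nonneg _) (abs_wave_le _ _ _)) (abs_nonneg _)
  have h1 := hasSum_integral_of_summable_integral_norm hint hsum
  have h2 : ∀ i, ∫ x, c i * modeConst (q i).1 * wave (q i).1 (modeShift (q i).2) x * ψ j x ∂P =
      if i = j then c j else 0 := by
    intro i
    have h3 : ∫ x, c i * modeConst (q i).1 * wave (q i).1 (modeShift (q i).2) x * ψ j x ∂P =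
        c i * l2inner P (ψ i) (ψ j) := by
      rw [l2inner, ← integral_const_mul]
      refine integral_congr_ae ((ae_mem_of_compl_null hP).mono fun x hx => ?_)
      simp only [hq i x hx]
      ring
    rw [h3, hψ.orthonormal]
    split_ifs with hij
    · rw [hij, mul_one]
    · rw [mul_zero]
  simp only [h2, tsum_mul_right] at h1
  exact h1.unique (hasSum_ite_eq j (c j))

/-- The argument is an integer at least `2`, where zeta is a convergent series of nonnegative terms
with first nonzero term `1`. -/
theorem re_riemannZeta_pos {p n : ℕ} (h : d + n < p) :
    0 < (riemannZeta ((p : ℂ) - d + 1 - n)).re := by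
  have h1 : (p : ℂ) - d + 1 - n = ((p - d - n + 1 : ℕ) : ℂ) := by
    have : p = (p - d - n) + d + n := by omega
    generalize p - d - n = s at this
    subst this
    push_cast
    ring
  have hN : 1 < p - d - n + 1 := by omega
  generalize p - d - n + 1 = N at h1 hN
  have h2 : riemannZeta N = ((∑' m : ℕ, 1 / (m : ℝ) ^ N : ℝ) : ℂ) := by
    rw [zeta_nat_eq_tsum_of_gt_one hN]
    push_cast
    rfl
  rw [h1, h2, Complex.ofReal_re]
  exact (Real.summable_one_div_nat_pow.mpr hN).tsum_pos (fun m => by positivity) 1 (by simp)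

/-! ### Derivatives up to the boundary -/

theorem IsCm.exists_eqOn_derivOn {X : Set (E d)} (hXint : X ⊆ closure (interior X)) {m : ℕ}
    {F : E d → ℝ} (hF : IsCm X m F) {β : Fin d → ℕ} (hβ : order β ≤ m) :
    ∃ g : E d → ℝ, ContinuousOn g X ∧ EqOn g (mpartial β F) (interior X) ∧
      EqOn (derivOn X β F) g X := by
  obtain ⟨-, g, hg, hge⟩ := hF.2 β hβ
  refine ⟨g, hg, hge, fun x hx => extendFrom_eq (hXint hx) ?_⟩
  exact (((hg x hx).mono interior_subset).tendsto).congr'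
    (eventually_of_mem self_mem_nhdsWithin fun z hz => hge hz)

/-- The identity with `∂^β h` holds in the open interior only; the bound reaches the boundary by
continuity of the extended derivatives. -/
theorem IsCm.abs_derivOn_sub_le {X : Set (E d)} (hXint : X ⊆ closure (interior X)) {m : ℕ}
    {F f h : E d → ℝ} (hF : IsCm X m F) (hf : IsCm X m f) {β : Fin d → ℕ} (hβ : order β ≤ m)
    (he : EqOn (fun x => F x - f x) h X) {B : ℝ} (hB : ∀ x, |mpartial β h x| ≤ B) :
    ∀ x ∈ X, |derivOn X β F x - derivOn X β f x| ≤ B := by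
  obtain ⟨G, hG, hGe, hGd⟩ := hF.exists_eqOn_derivOn hXint hβ
  obtain ⟨g, hg, hge, hgd⟩ := hf.exists_eqOn_derivOn hXint hβ
  intro x hx
  rw [hGd hx, hgd hx]
  have : (𝓝[interior X] x).NeBot := mem_closure_iff_nhdsWithin_neBot.mp (hXint hx)
  refine le_of_tendsto (((hG.sub hg).abs x hx).mono interior_subset).tendsto
    (eventually_of_mem self_mem_nhdsWithin fun z hz => ?_)
  have h1 := (HasIterPartialOn.sub isOpen_interior (hF.2 β hβ).1 (hf.2 β hβ).1).2 hz
  have h2 := iterPartial_congr isOpen_interior (he.mono interior_subset) (indexList β) hz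
  have h3 : G z - g z = mpartial β h z := by
    rw [hGe hz, hge hz]
    exact h1.symm.trans h2
  exact (congrArg abs h3).trans_le (hB z)

variable {H : Type*} [NormedAddCommGroup H] [InnerProductSpace ℝ H] [CompleteSpace H]
  {Φ : E d → H}

/-- If `L_K^{-r} f₀` is smooth on the torus, the error of the regularized function is a Fourier
series whose derivatives are `O(lam ^ r)`. -/
theorem exists_fourier_error [IsFiniteMeasure P] (hd : 1 ≤ d) (hP : P = volume.restrict (cube d))
    (hPsupp : ∀ x ∈ cube d, ∀ U ∈ 𝓝 x, 0 < P U) (hΦc : ContinuousOn Φ (cube d))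
    (hΦ : ∀ x ∈ cube d, ∀ y ∈ cube d, inner ℝ (Φ x) (Φ y) = K x y)
    (hψ : IsEigenSystem (cube d) P K ev ψ) (hF : ∀ i, IsFourierFunction (ψ i))
    {f₀ g : E d → ℝ} (hf₀ : ContinuousOn f₀ (cube d)) (β : Fin d → ℕ) {r : ℝ} (hr0 : 0 ≤ r)
    (hr1 : r ≤ 1) {p : ℕ} (hp : d + order β < p) (hg : IsPeriodicCp p g)
    (hpow : IsPow P ev ψ (-r) f₀ g) :
    ∃ B : ℝ, 0 ≤ B ∧ ∀ lam : ℝ, 0 < lam → ∀ F, IsRegularized (cube d) P K lam f₀ F →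
      ∃ h : E d → ℝ, EqOn (fun x => F x - f₀ x) h (cube d) ∧
        ∀ x, |mpartial β h x| ≤ B * lam ^ r := by
  have hPX : P (cube d)ᶜ = 0 := by
    rw [hP, Measure.restrict_apply isCompact_cube.measurableSet.compl]
    simp
  choose q hq using fun i => (hF i).exists_mode
  obtain ⟨M, hM0, hM⟩ := hg.exists_decay_norm hd
  have hS := (summable_mode (Nat.lt_succ_self d)).comp_injective (hψ.injective_mode hPX hq)
  simp only [Function.comp_def] at hS
  set n := order β with hn
  have h2pi := Real.two_pi_pos
  -- Here `2 = √2 · √2` comes from the normalisation of the mode, once in the coefficient and once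
  -- in the series; `(2π)^n` comes from `n` derivatives. The exponent `d + 1` is what `p ≥ n + d +
  -- 1` leaves of the decay.
  refine ⟨2 * M * (2 * Real.pi) ^ n * ∑' i, ((1 + ‖(q i).1‖) ^ (d + 1))⁻¹, ?_, ?_⟩
  · exact mul_nonneg (by positivity) (tsum_nonneg fun i => by positivity)
  intro lam hlam F hreg
  have hf₂ := memLp_of_continuousOn isCompact_cube hPX hf₀ 2
  set c : ℕ → ℝ := fun i => -(lam / (ev i + lam)) * l2inner P f₀ (ψ i) with hc
  have hcle : ∀ i, |c i| ≤ lam ^ r * (Real.sqrt 2 * (M / (1 + ‖(q i).1‖) ^ p)) := by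
    intro i
    have h0 := hψ.pos i
    have h1 : c i = -(lam * ev i ^ r / (ev i + lam)) * l2inner P g (ψ i) := by
      have h2 : ev i ^ r * ev i ^ (-r) = 1 := by
        rw [← Real.rpow_add h0, add_neg_cancel, Real.rpow_zero]
      rw [hpow.2 i]
      calc c i = -(lam / (ev i + lam)) * l2inner P f₀ (ψ i) * (ev i ^ r * ev i ^ (-r)) := by
            rw [h2, mul_one]
        _ = _ := by ring
    have h3 : |l2inner P g (ψ i)| ≤ Real.sqrt 2 * (M / (1 + ‖(q i).1‖) ^ p) := by
      rw [hP]; exact abs_l2inner_mode_le hM (hq i)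
    rw [h1, abs_mul, abs_neg, abs_of_nonneg (by positivity)]
    exact mul_le_mul (mul_rpow_div_add_le hlam h0 hr0 hr1) h3 (abs_nonneg _) (by positivity)
  have hale : ∀ i, |c i * modeConst (q i).1| * (2 * Real.pi * (1 + ‖(q i).1‖)) ^ n ≤
      2 * M * (2 * Real.pi) ^ n * lam ^ r * ((1 + ‖(q i).1‖) ^ (d + 1))⁻¹ := by
    intro i
    have hk : 1 ≤ 1 + ‖(q i).1‖ := by linarith [norm_nonneg (q i).1]
    have h1 : |c i * modeConst (q i).1| ≤ 2 * M * lam ^ r * ((1 + ‖(q i).1‖) ^ p)⁻¹ := by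
      rw [abs_mul]
      refine (mul_le_mul (hcle i) (abs_modeConst_le _) (abs_nonneg _) (by positivity)).trans_eq ?_
      have := Real.mul_self_sqrt (zero_le_two (α := ℝ))
      calc _ = Real.sqrt 2 * Real.sqrt 2 * M * lam ^ r * ((1 + ‖(q i).1‖) ^ p)⁻¹ := by
            rw [div_eq_mul_inv]; ring
        _ = _ := by rw [this]
    have h2 : ((1 + ‖(q i).1‖) ^ p)⁻¹ * (1 + ‖(q i).1‖) ^ n ≤ ((1 + ‖(q i).1‖) ^ (d + 1))⁻¹ := by
      have h3 : (1 + ‖(q i).1‖) ^ (n + (d + 1)) ≤ (1 + ‖(q i).1‖) ^ p :=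
        pow_le_pow_right₀ hk (by omega)
      rw [pow_add] at h3
      rw [inv_mul_le_iff₀ (by positivity), ← div_eq_mul_inv, le_div_iff₀ (by positivity)]
      exact h3
    calc _ ≤ 2 * M * lam ^ r * ((1 + ‖(q i).1‖) ^ p)⁻¹ * (2 * Real.pi * (1 + ‖(q i).1‖)) ^ n := by
          gcongr
      _ = 2 * M * (2 * Real.pi) ^ n * lam ^ r *
          (((1 + ‖(q i).1‖) ^ p)⁻¹ * (1 + ‖(q i).1‖) ^ n) := by rw [mul_pow]; ring
      _ ≤ _ := by gcongr
  have hu := hS.mul_left (2 * M * (2 * Real.pi) ^ n * lam ^ r)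
  have hsum : Summable fun i => |c i * modeConst (q i).1| := by
    refine Summable.of_nonneg_of_le (fun i => abs_nonneg _) (fun i => (le_trans ?_ (hale i))) hu
    exact le_mul_of_one_le_right (abs_nonneg _) (one_le_pow₀ (one_le_two_pi_mul _))
  refine ⟨fun x => ∑' i, c i * modeConst (q i).1 * wave (q i).1 (modeShift (q i).2) x, ?_, ?_⟩
  · refine hψ.eqOn_of_l2inner_eq isCompact_cube hPX hPsupp ?_
      (continuous_tsum_wave hsum).continuousOn fun i => ?_
    · exact ((hΦc.inner continuousOn_const).congr
        (hreg.eqOn_inner isCompact_cube hPX hΦc hΦ hf₂ hlam)).sub hf₀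
    · rw [hψ.l2inner_tsum_mode hPX hq hsum,
        hreg.l2inner_sub_eq isCompact_cube hPX hΦc hΦ hψ hf₂ hlam]
  · intro x
    refine (abs_mpartial_tsum_wave_le β hu hale x).trans_eq ?_
    rw [tsum_mul_left]
    ring

end KRR

theorem mainTheorem4 {d : ℕ} (hd : 1 ≤ d) (X : Set (KRR.E d)) (hX : IsCompact X)
    (hXint : X ⊆ closure (interior X))
    (P : Measure (KRR.E d)) [IsProbabilityMeasure P] (hPX : P Xᶜ = 0)
    (hPdens : P ≪ volume) (hPsupp : ∀ x ∈ X, ∀ U ∈ 𝓝 x, 0 < P U)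
    (K : KRR.E d → KRR.E d → ℝ) (hK : KRR.IsMercerKernel X K)
    (ev : ℕ → ℝ) (ψ : ℕ → KRR.E d → ℝ) (hψ : KRR.IsEigenSystem X P K ev ψ)
    (m : ℕ) (hKm : KRR.IsC2m X m K)
    (f₀ : KRR.E d → ℝ) (hf₀ : KRR.IsCm X m f₀)
    (β : Fin d → ℕ) (hβ : KRR.order β ≤ m) :
    -- the regularized function exists and all derivatives in question exist
    (∀ lam : ℝ, 0 < lam →
      (∃ F, KRR.IsRegularized X P K lam f₀ F) ∧
      ∀ F, KRR.IsRegularized X P K lam f₀ F → KRR.IsCm X m F) ∧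
    -- part (a)
    ((∃ Cψ : ℝ, 0 < Cψ ∧ ∀ i, ∀ x ∈ X, |ψ i x| ≤ Cψ) →
      ∀ r : ℝ, 0 < r → r ≤ 1 / 2 → ∀ g, KRR.IsPow P ev ψ (-r - 1 / 2) f₀ g →
        ∀ lam : ℝ, 0 < lam → ∀ F, KRR.IsRegularized X P K lam f₀ F →
          KRR.supNorm X (fun x => KRR.derivOn X β F x - KRR.derivOn X β f₀ x) ≤
            ENNReal.ofReal (KRR.kappa X β K * lam ^ r * (eLpNorm g 2 P).toReal)) ∧
    -- part (b)
    (X = KRR.cube d → P = volume.restrict (KRR.cube d) →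
      (∀ i, KRR.IsFourierFunction (ψ i)) →
      ∀ r : ℝ, 0 < r → r ≤ 1 → ∀ p : ℕ, d + KRR.order β < p →
        ∀ g, KRR.IsPeriodicCp p g → KRR.IsPow P ev ψ (-r) f₀ g →
          ∃ C : ℝ, 0 < C ∧ ∀ lam : ℝ, 0 < lam → ∀ F, KRR.IsRegularized X P K lam f₀ F →
            KRR.supNorm X (fun x => KRR.derivOn X β F x - KRR.derivOn X β f₀ x) ≤
              ENNReal.ofReal
                (C * lam ^ r * (riemannZeta ((p : ℂ) - d + 1 - KRR.order β)).re)) := by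
  obtain ⟨H, _, _, _, Φ, hΦ⟩ := hK.exists_feature
  have hΦc := KRR.continuousOn_feature hΦ hKm.1
  have hf₂ := KRR.memLp_of_continuousOn hX hPX hf₀.1 2
  have hCm : ∀ lam : ℝ, 0 < lam → ∀ F, KRR.IsRegularized X P K lam f₀ F → KRR.IsCm X m F :=
    fun lam hlam F hF =>
      hKm.isCm_of_eqOn_inner hX hXint hΦ (hF.eqOn_inner hX hPX hΦc hΦ hf₂ hlam)
  refine ⟨fun lam hlam => ⟨KRR.exists_isRegularized hX hPX hPsupp hΦc hΦ hψ hf₂ hlam,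
    hCm lam hlam⟩, ?_, ?_⟩
  · intro _ r hr0 hr1 g hg lam hlam F hF
    -- The Hilbert space estimate is valid for all `0 ≤ r ≤ 1`.
    exact hF.supNorm_derivOn_sub_le hX hXint hPX hPsupp hKm hΦ hψ hβ hf₀.1 hlam hr0.le
      (hr1.trans (by norm_num)) hg
  · intro hXc hP hfour r hr0 hr1 p hp g hg hpow
    subst hXc
    obtain ⟨B, hB0, hB⟩ := KRR.exists_fourier_error hd hP hPsupp hΦc hΦ hψ hfour hf₀.1 β hr0.le
      hr1 hp hg hpow
    have hz := KRR.re_riemannZeta_pos hp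
    -- Dividing by the positive zeta value cancels it from the bound; `B + 1` keeps the constant
    -- positive when `B = 0`.
    refine ⟨(B + 1) / (riemannZeta ((p : ℂ) - d + 1 - KRR.order β)).re, by positivity,
      fun lam hlam F hF => KRR.supNorm_le fun x hx => ?_⟩
    obtain ⟨h, he, hb⟩ := hB lam hlam F hF
    refine ((hCm lam hlam F hF).abs_derivOn_sub_le hXint hf₀ hβ he hb x hx).trans ?_
    rw [mul_right_comm, div_mul_cancel₀ _ hz.ne']
    have := Real.rpow_nonneg hlam.le r
    nlinarith
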